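/- **Theorem 2.1.** Let $G$ be a (finite-dimensional, real) Lie group with Lie algebra $\mathfrak g=T_eG$, bracket $\operatorname{ad}_\xi\eta=[\xi,\eta]$ induced by left-invariant vector fields, and $\langle \operatorname{ad}^*_\xi\mu,\eta\rangle=\langle\mu,\operatorname{ad}_\xi\eta\rangle$ for $\mu\in\mathfrak g^*$. Fix a real number $a>0$ and write $\mathcal C(M)$ for the smooth curves $[0,a]\to M$ in a smooth manifold $M$. Let $T^{(2)}G$ be the set of classes of smooth curves $\gamma$ in $G$ having the same derivatives at $0$ up to order $2$ in every chart; left trivialisation identifies it with $G\times\mathfrak g\times\mathfrak g$ via $[\gamma]\mapsto(\gamma(0),\xi(0),\dot\xi(0))$, $\xi:=\gamma^{-1}\dot\gamma$. Let $L:T^{(2)}G\to\mathbb R$ be left-invariant, i.e. its left trivialisation does not depend on the entry in $G$, so that $L([\gamma])=\ell(\xi(0),\dot\xi(0))$ with a reduced Lagrangian $\ell:\mathfrak g\times\mathfrak g\to\mathbb R$, assumed smooth. Identify the second-order Pontryagin bundle $P^{(2)}G=T^{(2)}G\times_{TG}T^*(TG)$ with $G\times\mathfrak g\times\mathfrak g\times\mathfrak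 g^*\times\mathfrak g^*$ by left trivialisation, with points $(g,\xi,u,\mu,\nu)$, and let $\Pi:P^{(2)}G\to G$ be the projection. For a curve $g\in\mathcal C(G)$ the following are equivalent. 1. *Hamilton's principle.* The curve $g$ satisfies $\delta S(g)=0$ for $$S(g)=\int_0^a L(g,\dot g,\ddot g)\,dt,$$ with respect to all smooth variations of $g$ which fix $g(0),g(a),\dot g(0),\dot g(a)$. 2. *Reduced Hamilton's principle.* The curve $v:=g^{-1}\dot g$ satisfies $\delta s(v)=0$ for $s(v)=\int_0^a\ell(v,\dot v)\,dt$, with respect to variations $\delta v=\dot\eta+\operatorname{ad}_v\eta$, where $\eta\in\mathcal C(\mathfrak g)$ and $\eta(0)=\eta(a)=\dot\eta(0)=\dot\eta(a)=0$. 3. *Reduced higher-order Hamilton–Pontryagin principle.* There is a curve $\gamma=(g,\xi,u,\mu,\nu)\in\mathcal C(P^{(2)}G)$ with $\Pi\circ\gamma=g$ that satisfies $\delta s_{hp}(\gamma)=0$ for $$s_{hp}(\gamma)=\int_0^a \ell(\xi,u)+\langle\mu,g^{-1}\dot g-\xi\rangle+\langle\nu,\dot\xi-u\rangle\,dt,$$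 with respect to all smooth variations of $\gamma$ with $\delta g(0)=\delta g(a)=0$ and $\delta\xi(0)=\delta\xi(a)=0$. Each of these statements is moreover equivalent to the existence of a curve $\gamma=(g,\xi,u,\mu,\nu)\in\mathcal C(P^{(2)}G)$ with $\Pi\circ\gamma=g$ that satisfies on $[0,a]$ the second-order Euler–Poincaré equations $$\dot\mu=\operatorname{ad}^*_\xi\mu,$$ together with the Ostrogradsky momenta and the reconstruction equations $$\mu=\frac{\delta\ell}{\delta\xi}-\dot\nu,\qquad \nu=\frac{\delta\ell}{\delta u},\qquad \dot g=g\xi,\qquad \dot\xi=u.$$ More precisely, a curve $\gamma\in\mathcal C(P^{(2)}G)$ with $\Pi\circ\gamma=g$ satisfies $\delta s_{hp}(\gamma)=0$ for the variations in (3) if and only if it satisfies these equations. -/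

import Mathlib

open scoped Manifold ContDiff

noncomputable section

namespace SecondOrderEP

/-- `SmoothCurve J M` is the space of smooth curves in the manifold `M`. A smooth curve on the compact
interval `[0, a]` is represented by a smooth map on `ℝ` extending it; every notion below depends
only on the restriction of the curves to `[0, a]`. -/
abbrev SmoothCurve {F : Type*} [NormedAddCommGroup F] [NormedSpace ℝ F]
    {K : Type*} [TopologicalSpace K] (J : ModelWithCorners ℝ F K)
    (M : Type*) [TopologicalSpace M] [ChartedSpace K M] : Type _ :=
  ContMDiffMap 𝓘(ℝ, ℝ) J ℝ M ∞

/-- A smooth one-parameter family `Γ ε` of curves that equals `c` on `[0, a]` for `ε = 0`: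
`ε` is the deformation parameter, and `(ε, t) ↦ Γ ε t` is jointly smooth. -/
structure IsDeformation {F : Type*} [NormedAddCommGroup F] [NormedSpace ℝ F]
    {K : Type*} [TopologicalSpace K] {J : ModelWithCorners ℝ F K}
    {M : Type*} [TopologicalSpace M] [ChartedSpace K M]
    (a : ℝ) (c : SmoothCurve J M) (Γ : ℝ → SmoothCurve J M) : Prop where
  smooth : ContMDiff 𝓘(ℝ, ℝ × ℝ) J ∞ (fun p : ℝ × ℝ => Γ p.1 p.2)
  start : ∀ t ∈ Set.Icc 0 a, Γ 0 t = c t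

section Group

/-! `G` is a Lie group modelled on the finite-dimensional space `E`. Mathlib's tangent spaces,
and in particular the Lie algebra `𝔤 = T₁G`, are by definition copies of the model space `E`, so
elements of `𝔤` are written as elements of `E`, and elements of `𝔤*` as elements of
`StrongDual ℝ E`. -/

variable {E : Type*} [NormedAddCommGroup E] [NormedSpace ℝ E]
  {G : Type*} [TopologicalSpace G] [ChartedSpace E G] [Group G]

variable (G) in
/-- `ad_x y = [x, y]`, the bracket of the Lie algebra of `G` (left-invariant vector fields). -/
def ad (x y : E) : E :=
  Bracket.bracket (L := GroupLieAlgebra 𝓘(ℝ, E) G) (M := GroupLieAlgebra 𝓘(ℝ, E) G) x y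

variable (E) in
/-- The velocity `ġ(t)`, a tangent vector at `g(t)`. -/
def velocity (g : ℝ → G) (t : ℝ) : TangentSpace 𝓘(ℝ, E) (g t) :=
  mfderiv 𝓘(ℝ, ℝ) 𝓘(ℝ, E) g t (1 : ℝ)

/-- The left-trivialised velocity `g⁻¹ ġ = T L_{g⁻¹} ġ ∈ 𝔤`. -/
def leftVelocity (g : ℝ → G) (t : ℝ) : E :=
  mfderiv 𝓘(ℝ, E) 𝓘(ℝ, E) (fun h : G => (g t)⁻¹ * h) (g t) (velocity E g t)

variable (E) in
/-- The point `(g(t), ġ(t))` of `TG`. -/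
def tangentLift (g : ℝ → G) (t : ℝ) : TangentBundle 𝓘(ℝ, E) G := ⟨g t, velocity E g t⟩

variable (E G) in
/-- Two curves are `k`-equivalent if their derivatives at time `0` up to order `k` coincide in
every smooth local chart around the common base point. -/
def jetSetoid (k : ℕ) : Setoid (SmoothCurve 𝓘(ℝ, E) G) where
  r γ₁ γ₂ := γ₁ 0 = γ₂ 0 ∧
    ∀ φ ∈ IsManifold.maximalAtlas 𝓘(ℝ, E) ∞ G, γ₁ 0 ∈ φ.source →
      ∀ l ≤ k, iteratedDeriv l (fun s => φ (γ₁ s)) 0 = iteratedDeriv l (fun s => φ (γ₂ s)) 0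
  iseqv :=
    { refl := fun _ => ⟨rfl, fun _ _ _ _ _ => rfl⟩
      symm := fun h => ⟨h.1.symm, fun φ hφ hs l hl => (h.2 φ hφ (h.1 ▸ hs) l hl).symm⟩
      trans := fun h h' => ⟨h.1.trans h'.1, fun φ hφ hs l hl =>
        (h.2 φ hφ hs l hl).trans (h'.2 φ hφ (h.1 ▸ hs) l hl)⟩ }

variable (E G) in
/-- The `k`-th order tangent bundle `T^(k) G`: equivalence classes `[γ]^(k)` of curves. -/
def HigherTangentBundle (k : ℕ) : Type _ := Quotient (jetSetoid E G k)

/-- The curve `s ↦ g(t + s)`. -/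
def shift (g : SmoothCurve 𝓘(ℝ, E) G) (t : ℝ) : SmoothCurve 𝓘(ℝ, E) G :=
  ⟨fun s => g (t + s), g.contMDiff.comp (contDiff_const.add contDiff_id).contMDiff⟩

/-- The point `(g(t), ġ(t), …, g^(k)(t))` of `T^(k) G`, that is, the class of `s ↦ g(t + s)`. -/
def jet (k : ℕ) (g : SmoothCurve 𝓘(ℝ, E) G) (t : ℝ) : HigherTangentBundle E G k :=
  Quotient.mk (jetSetoid E G k) (shift g t)

/-- `l : G × 𝔤 × 𝔤 → ℝ` is the left trivialisation of `L : T^(2) G → ℝ`, where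
`T^(2) G ≅ G × 𝔤 × 𝔤` maps `[γ]` to `(γ(0), ξ(0), ξ̇(0))` with `ξ = γ⁻¹ γ̇`. -/
def IsLeftTrivialisation (L : HigherTangentBundle E G 2 → ℝ) (l : G → E × E → ℝ) : Prop :=
  ∀ γ : SmoothCurve 𝓘(ℝ, E) G,
    L (Quotient.mk (jetSetoid E G 2) γ) =
      l (γ 0) (leftVelocity γ 0, deriv (leftVelocity γ) 0)

/-- `L` is left-invariant with reduced Lagrangian `ℓ`: the left trivialisation of `L` does not
depend on the entry in `G`, and equals `ℓ`. -/
def IsReducedLagrangian (L : HigherTangentBundle E G 2 → ℝ) (ℓ : E × E → ℝ) : Prop :=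
  IsLeftTrivialisation L (fun _ : G => ℓ)

/-! ### Hamilton's principle -/

/-- `S(g) = ∫₀ᵃ L(g, ġ, g̈) dt`. -/
def action (a : ℝ) (L : HigherTangentBundle E G 2 → ℝ) (g : SmoothCurve 𝓘(ℝ, E) G) : ℝ :=
  ∫ t in (0 : ℝ)..a, L (jet 2 g t)

/-- `δS(g) = 0` for all variations of `g` which fix `g` and `ġ` at `t = 0` and `t = a`. -/
def HamiltonPrinciple (a : ℝ) (L : HigherTangentBundle E G 2 → ℝ)
    (g : SmoothCurve 𝓘(ℝ, E) G) : Prop :=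
  ∀ Γ : ℝ → SmoothCurve 𝓘(ℝ, E) G, IsDeformation a g Γ →
    (∀ ε, tangentLift E (Γ ε) 0 = tangentLift E g 0) →
    (∀ ε, tangentLift E (Γ ε) a = tangentLift E g a) →
    HasDerivAt (fun ε => action a L (Γ ε)) 0 0

/-! ### Reduced Hamilton's principle -/

/-- `s(v) = ∫₀ᵃ ℓ(v, v̇) dt`. -/
def reducedAction (a : ℝ) (ℓ : E × E → ℝ) (v : ℝ → E) : ℝ :=
  ∫ t in (0 : ℝ)..a, ℓ (v t, deriv v t)

variable (G) in
/-- `δs(v) = 0` for all variations `δv = η̇ + ad_v η`, where `η` and `η̇` vanish at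
`t = 0` and `t = a`. -/
def ReducedHamiltonPrinciple (a : ℝ) (ℓ : E × E → ℝ) (v : ℝ → E) : Prop :=
  ∀ η : ℝ → E, ContDiff ℝ ∞ η → η 0 = 0 → η a = 0 → deriv η 0 = 0 → deriv η a = 0 →
    HasDerivAt
      (fun ε : ℝ => reducedAction a ℓ (fun t => v t + ε • (deriv η t + ad G (v t) (η t)))) 0 0

/-! ### Reduced Hamilton–Pontryagin principle -/

variable (E G) in
/-- The (left-trivialised) second-order Pontryagin bundle
`P^(2) G ≅ G × 𝔤 × 𝔤 × 𝔤* × 𝔤*`, with points `(g, ξ, u, μ, ν)`. -/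
abbrev PontryaginBundle : Type _ := G × (E × E × StrongDual ℝ E × StrongDual ℝ E)

variable (E) in
/-- The model of `P^(2) G` as a smooth manifold. -/
abbrev pontryaginModel :=
  (𝓘(ℝ, E)).prod 𝓘(ℝ, E × E × StrongDual ℝ E × StrongDual ℝ E)

namespace PontryaginBundle

/-- The projection `Π : P^(2) G → G`. -/
abbrev g (p : PontryaginBundle E G) : G := p.1
/-- The component `ξ`. -/
abbrev ξ (p : PontryaginBundle E G) : E := p.2.1
/-- The component `u`. -/
abbrev u (p : PontryaginBundle E G) : E := p.2.2.1
/-- The component `μ`. -/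
abbrev μ (p : PontryaginBundle E G) : StrongDual ℝ E := p.2.2.2.1
/-- The component `ν`. -/
abbrev ν (p : PontryaginBundle E G) : StrongDual ℝ E := p.2.2.2.2

end PontryaginBundle

open PontryaginBundle

variable (E G) in
/-- Smooth curves in the second-order Pontryagin bundle. -/
abbrev PontryaginCurve : Type _ := SmoothCurve (pontryaginModel E) (PontryaginBundle E G)

/-- `s_hp(γ) = ∫₀ᵃ ℓ(ξ, u) + ⟨μ, g⁻¹ġ - ξ⟩ + ⟨ν, ξ̇ - u⟩ dt`. -/
def hpAction (a : ℝ) (ℓ : E × E → ℝ) (γ : PontryaginCurve E G) : ℝ :=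
  ∫ t in (0 : ℝ)..a,
    (ℓ (ξ (γ t), u (γ t))
      + μ (γ t) (leftVelocity (fun s => g (γ s)) t - ξ (γ t))
      + ν (γ t) (deriv (fun s => ξ (γ s)) t - u (γ t)))

/-- `δs_hp(γ) = 0` for all variations of `γ` with `δg(0) = δg(a) = 0` and
`δξ(0) = δξ(a) = 0`. -/
def IsHPStationary (a : ℝ) (ℓ : E × E → ℝ) (γ : PontryaginCurve E G) : Prop :=
  ∀ Γ : ℝ → PontryaginCurve E G, IsDeformation a γ Γ →
    velocity E (fun ε => g (Γ ε 0)) 0 = 0 → velocity E (fun ε => g (Γ ε a)) 0 = 0 →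
    deriv (fun ε => ξ (Γ ε 0)) 0 = 0 → deriv (fun ε => ξ (Γ ε a)) 0 = 0 →
    HasDerivAt (fun ε => hpAction a ℓ (Γ ε)) 0 0

/-- The curve `γ` in `P^(2) G` projects to `c` on `[0, a]`. -/
def ProjectsTo (a : ℝ) (γ : PontryaginCurve E G) (c : SmoothCurve 𝓘(ℝ, E) G) : Prop :=
  ∀ t ∈ Set.Icc 0 a, g (γ t) = c t

/-- The second-order Euler–Poincaré equation `μ̇ = ad*_ξ μ` (where
`⟨ad*_ξ μ, η⟩ = ⟨μ, ad_ξ η⟩`), the Ostrogradsky momenta `μ = δℓ/δξ - ν̇` and `ν = δℓ/δu`, and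
the reconstruction equations `ġ = g ξ` and `ξ̇ = u`, on `[0, a]`. -/
structure HPEquations (a : ℝ) (ℓ : E × E → ℝ) (γ : PontryaginCurve E G) : Prop where
  euler_poincare : ∀ t ∈ Set.Icc 0 a, ∀ η : E,
    deriv (fun s => μ (γ s)) t η = μ (γ t) (ad G (ξ (γ t)) η)
  momentum_mu : ∀ t ∈ Set.Icc 0 a,
    μ (γ t) = fderiv ℝ (fun x => ℓ (x, u (γ t))) (ξ (γ t)) - deriv (fun s => ν (γ s)) t
  momentum_nu : ∀ t ∈ Set.Icc 0 a,
    ν (γ t) = fderiv ℝ (fun w => ℓ (ξ (γ t), w)) (u (γ t))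
  reconstruction_g : ∀ t ∈ Set.Icc 0 a,
    velocity E (fun s => g (γ s)) t =
      mulInvariantVectorField (I := 𝓘(ℝ, E)) (G := G) (ξ (E := E) (γ t)) (g (γ t))
  reconstruction_xi : ∀ t ∈ Set.Icc 0 a, deriv (fun s => ξ (γ s)) t = u (γ t)

end Group

end SecondOrderEP

end

/-! Left invariance gives `S(g) = s(v)` with `v = g⁻¹ġ`, so everything rests on how `v` varies with
`g`. Put `η = g⁻¹δg`. The left Maurer–Cartan form satisfies its structure equation
(`fderiv_maurerCartan`), and evaluating that equation on `∂_ε` and `∂_t` gives `δv = η̇ + ad_v η`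
(`hasDerivAt_leftVelocity_variation`). Conversely every smooth `η` comes from the deformation `g
σ(εη)`, where `σ` is a smooth map `𝔤 → G` with `σ 0 = 1` and identity derivative at `0`
(`exists_deformation`). Fixing `g` and `ġ` at the ends forces `η` and `η̇` to vanish there, and if
they vanish this deformation fixes both. Hence the first two principles are the same linear
condition on `η`, `IsReducedCritical`.

With `ν = ∂ℓ/∂u` and `μ = ∂ℓ/∂ξ - ν̇`, integration by parts turns that condition into `∫ ⟨μ, ad_v η⟩
- ⟨μ̇, η⟩ = 0` (`integral_reduced_variation`). By the fundamental lemma of the calculus of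
variations this is the Euler–Poincaré equation.

For the Hamilton–Pontryagin action the same variation formula and one integration by parts give an
integrand in which `η`, `δξ`, `δu`, `δμ`, `δν` occur linearly (`hpVariation`). They can be
prescribed independently, and their coefficients are the five equations. -/

noncomputable section

namespace SecondOrderEP

open Set Filter Topology MeasureTheory VectorField

/-! ### The left Maurer–Cartan form and its structure equation. -/

section MaurerCartan

variable {E : Type*} [NormedAddCommGroup E] [NormedSpace ℝ E]
  {G : Type*} [TopologicalSpace G] [ChartedSpace E G] [Group G]
  {X : Type*} [NormedAddCommGroup X] [NormedSpace ℝ X]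

variable (E) in
/-- The pullback `Γ⁻¹ dΓ` of the left Maurer–Cartan form, computed in the chart at `1`. -/
def maurerCartan (Γ : X → G) (x : X) : X →L[ℝ] E :=
  fderiv ℝ (fun y => extChartAt 𝓘(ℝ, E) (1 : G) ((Γ x)⁻¹ * Γ y)) x

variable (E G) in
/-- The Maurer–Cartan form in the chart at `1`. -/
def chartForm (z : E) : E →L[ℝ] E :=
  maurerCartan E (fun y => (extChartAt 𝓘(ℝ, E) (1 : G)).symm y) z

/-- The manifold derivative is read in the preferred chart at the value of the map. At value `1`
this is the fixed chart used in `maurerCartan`, which is why the form is computed after translating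
to `1`. -/
theorem mfderiv_eq_fderiv_extChartAt_one {f : X → G} {x : X}
    (hf : MDifferentiableAt 𝓘(ℝ, X) 𝓘(ℝ, E) f x) (h1 : f x = 1) :
    (mfderiv 𝓘(ℝ, X) 𝓘(ℝ, E) f x : X →L[ℝ] E) =
      fderiv ℝ (fun y => extChartAt 𝓘(ℝ, E) (1 : G) (f y)) x := by
  refine (if_pos hf).trans ?_
  change fderivWithin ℝ (fun y => extChartAt 𝓘(ℝ, E) (f x) (f y)) (range id) x = _
  rw [h1, range_id, fderivWithin_univ]

variable [LieGroup 𝓘(ℝ, E) ∞ G]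

theorem mdifferentiable_const_mul (p : G) :
    MDifferentiable 𝓘(ℝ, E) 𝓘(ℝ, E) (fun h : G => p * h) :=
  (contMDiff_mul_left (I := 𝓘(ℝ, E)) (n := ∞)).mdifferentiable (by simp)

theorem mfderiv_inv_mul_comp_mfderiv {Γ : X → G} {x : X}
    (hΓ : MDifferentiableAt 𝓘(ℝ, X) 𝓘(ℝ, E) Γ x) :
    ((mfderiv 𝓘(ℝ, E) 𝓘(ℝ, E) (fun h : G => (Γ x)⁻¹ * h) (Γ x)).comp
      (mfderiv 𝓘(ℝ, X) 𝓘(ℝ, E) Γ x) : X →L[ℝ] E) = maurerCartan E Γ x := by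
  have h := mfderiv_comp x (mdifferentiable_const_mul (E := E) (Γ x)⁻¹ (Γ x)) hΓ
  refine Eq.trans h.symm ?_
  exact mfderiv_eq_fderiv_extChartAt_one
    ((mdifferentiable_const_mul (E := E) (Γ x)⁻¹ (Γ x)).comp x hΓ) (by simp)

omit [Group G] [LieGroup 𝓘(ℝ, E) ∞ G] in
theorem velocity_comp {Γ : X → G} {c : ℝ → X} {t : ℝ}
    (hΓ : MDifferentiableAt 𝓘(ℝ, X) 𝓘(ℝ, E) Γ (c t)) {c' : X} (hc : HasDerivAt c c' t) :
    velocity E (fun s => Γ (c s)) t = mfderiv 𝓘(ℝ, X) 𝓘(ℝ, E) Γ (c t) c' := by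
  have h := mfderiv_comp t hΓ hc.differentiableAt.mdifferentiableAt
  have : (mfderiv 𝓘(ℝ, ℝ) 𝓘(ℝ, X) c t : ℝ →L[ℝ] X) (1 : ℝ) = c' := by
    rw [mfderiv_eq_fderiv]
    exact (fderiv_apply_one_eq_deriv : fderiv ℝ c t 1 = deriv c t).trans hc.deriv
  rw [← this]
  exact congrArg (fun A : ℝ →L[ℝ] E => A 1) h

theorem leftVelocity_comp {Γ : X → G} {c : ℝ → X} {t : ℝ}
    (hΓ : MDifferentiableAt 𝓘(ℝ, X) 𝓘(ℝ, E) Γ (c t)) {c' : X} (hc : HasDerivAt c c' t) :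
    leftVelocity (E := E) (fun s => Γ (c s)) t = maurerCartan E Γ (c t) c' := by
  rw [← mfderiv_inv_mul_comp_mfderiv hΓ]
  rw [leftVelocity, velocity_comp hΓ hc]
  rfl

theorem mfderiv_inv_mul_mulInvariantVectorField (h : G) (v : E) :
    (mfderiv 𝓘(ℝ, E) 𝓘(ℝ, E) (fun k : G => h⁻¹ * k) h
      (mulInvariantVectorField (I := 𝓘(ℝ, E)) (G := G) v h) : E) = v := by
  change (mfderiv 𝓘(ℝ, E) 𝓘(ℝ, E) (fun k : G => h⁻¹ * k) h
    (mfderiv 𝓘(ℝ, E) 𝓘(ℝ, E) (fun k : G => h * k) 1 v) : E) = v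
  have h3 := mfderiv_comp (1 : G) (mdifferentiable_const_mul (E := E) h⁻¹ (h * 1))
    (mdifferentiable_const_mul (E := E) h 1)
  have h4 : ((fun k => h⁻¹ * k) ∘ fun k => h * k) = (id : G → G) := by
    funext k; simp
  rw [h4, mfderiv_id] at h3
  -- The chain rule is based at `h * 1`; the base point is moved to `h` among linear maps of the
  -- model space.
  have h5 : ∀ k, k = h → (mfderiv 𝓘(ℝ, E) 𝓘(ℝ, E) (fun k : G => h⁻¹ * k) k : E →L[ℝ] E) =
      mfderiv 𝓘(ℝ, E) 𝓘(ℝ, E) (fun k : G => h⁻¹ * k) h := by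
    rintro k rfl; rfl
  rw [← h5 (h * 1) (mul_one h)]
  exact (congrArg (fun A : E →L[ℝ] E => A v) h3).symm

/-- Joint smoothness on the diagonal is needed because in `maurerCartan` the translating point moves
together with the point of differentiation. -/
theorem contDiffAt_extChartAt_inv_mul {Γ : X → G} {x : X}
    (hΓ : ContMDiffAt 𝓘(ℝ, X) 𝓘(ℝ, E) ∞ Γ x) :
    ContDiffAt ℝ ∞ (Function.uncurry
      (fun x y => extChartAt 𝓘(ℝ, E) (1 : G) ((Γ x)⁻¹ * Γ y))) (x, x) := by
  have h1 : ContMDiffAt 𝓘(ℝ, X × X) 𝓘(ℝ, E) ∞ (fun p : X × X => (Γ p.1)⁻¹ * Γ p.2) (x, x) :=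
    ((ContMDiffAt.comp (x, x) (by exact hΓ) contDiff_fst.contMDiff.contMDiffAt).inv).mul
      (ContMDiffAt.comp (x, x) (by exact hΓ) contDiff_snd.contMDiff.contMDiffAt)
  have h2 : ContMDiffAt 𝓘(ℝ, E) 𝓘(ℝ, E) ∞ (extChartAt 𝓘(ℝ, E) (1 : G)) ((Γ x)⁻¹ * Γ x) := by
    rw [inv_mul_cancel]
    exact contMDiffAt_extChartAt
  exact (ContMDiffAt.comp (x, x) h2 h1).contDiffAt

theorem contDiffAt_maurerCartan {Γ : X → G} {x : X}
    (hΓ : ContMDiffAt 𝓘(ℝ, X) 𝓘(ℝ, E) ∞ Γ x) :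
    ContDiffAt ℝ ∞ (maurerCartan E Γ) x :=
  ContDiffAt.fderiv (contDiffAt_extChartAt_inv_mul hΓ) contDiffAt_id (by simp)

theorem contDiff_maurerCartan {Γ : X → G} (hΓ : ContMDiff 𝓘(ℝ, X) 𝓘(ℝ, E) ∞ Γ) :
    ContDiff ℝ ∞ (maurerCartan E Γ) :=
  contDiff_iff_contDiffAt.2 fun x => contDiffAt_maurerCartan (hΓ x)

variable (E G) in
theorem eventually_contMDiffAt_extChartAt_symm :
    ∀ᶠ z in 𝓝 (extChartAt 𝓘(ℝ, E) (1 : G) 1),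
      ContMDiffAt 𝓘(ℝ, E) 𝓘(ℝ, E) ∞ (extChartAt 𝓘(ℝ, E) (1 : G)).symm z := by
  filter_upwards [extChartAt_target_mem_nhds (I := 𝓘(ℝ, E)) (1 : G)] with z hz
  exact (contMDiffOn_extChartAt_symm (1 : G)).contMDiffAt
    ((isOpen_extChartAt_target (1 : G)).mem_nhds hz)

variable (E G) in
theorem contDiffAt_chartForm :
    ContDiffAt ℝ ∞ (chartForm E G) (extChartAt 𝓘(ℝ, E) (1 : G) 1) :=
  contDiffAt_maurerCartan (eventually_contMDiffAt_extChartAt_symm E G).self_of_nhds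

omit [LieGroup 𝓘(ℝ, E) ∞ G] in
variable (E G) in
theorem chartForm_one :
    chartForm E G (extChartAt 𝓘(ℝ, E) (1 : G) 1) = ContinuousLinearMap.id ℝ E := by
  rw [chartForm, maurerCartan]
  have : (fun y => extChartAt 𝓘(ℝ, E) (1 : G)
      (((extChartAt 𝓘(ℝ, E) (1 : G)).symm (extChartAt 𝓘(ℝ, E) (1 : G) 1))⁻¹ *
        (extChartAt 𝓘(ℝ, E) (1 : G)).symm y)) =ᶠ[𝓝 (extChartAt 𝓘(ℝ, E) (1 : G) 1)] id := by
    filter_upwards [extChartAt_target_mem_nhds (I := 𝓘(ℝ, E)) (1 : G)] with z hz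
    rw [extChartAt_to_inv, inv_one, one_mul, PartialEquiv.right_inv _ hz, id]
  rw [this.fderiv_eq, fderiv_id]

variable (E G) in
/-- The left-invariant vector field with value `v` at `1`, in the chart at `1`. -/
def chartField (v : E) : E → E :=
  mpullbackWithin 𝓘(ℝ, E) 𝓘(ℝ, E) (extChartAt 𝓘(ℝ, E) (1 : G)).symm
    (mulInvariantVectorField (I := 𝓘(ℝ, E)) (G := G) v) (range 𝓘(ℝ, E))

-- Left translation by `h⁻¹` carries a left-invariant field at `h` back to its value at `1`. This
-- identity determines the field from the form, and differentiating it gives the derivative of the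
-- field.
variable (E G) in
theorem chartForm_chartField (v : E) :
    ∀ᶠ z in 𝓝 (extChartAt 𝓘(ℝ, E) (1 : G) 1), chartForm E G z (chartField E G v z) = v := by
  filter_upwards [extChartAt_target_mem_nhds (I := 𝓘(ℝ, E)) (1 : G),
    eventually_contMDiffAt_extChartAt_symm E G] with z hz hs
  have hs' := hs.mdifferentiableAt (by simp)
  set h : G := (extChartAt 𝓘(ℝ, E) (1 : G)).symm z with hh
  have e1 : chartForm E G z = ((mfderiv 𝓘(ℝ, E) 𝓘(ℝ, E) (fun k : G => h⁻¹ * k) h).comp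
      (mfderiv 𝓘(ℝ, E) 𝓘(ℝ, E) (extChartAt 𝓘(ℝ, E) (1 : G)).symm z) : E →L[ℝ] E) :=
    (mfderiv_inv_mul_comp_mfderiv hs').symm
  have e2 : mfderiv 𝓘(ℝ, E) 𝓘(ℝ, E) (extChartAt 𝓘(ℝ, E) (1 : G)).symm z (chartField E G v z) =
      mulInvariantVectorField (I := 𝓘(ℝ, E)) (G := G) v h := by
    have hi := isInvertible_mfderivWithin_extChartAt_symm (I := 𝓘(ℝ, E)) hz
    rw [chartField, mpullbackWithin_apply]
    simp only [ModelWithCorners.range_eq_univ, mfderivWithin_univ] at hi ⊢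
    exact hi.self_apply_inverse _
  rw [e1]
  refine (congrArg (mfderiv 𝓘(ℝ, E) 𝓘(ℝ, E) (fun k : G => h⁻¹ * k) h) e2).trans ?_
  exact mfderiv_inv_mul_mulInvariantVectorField h v

variable [CompleteSpace E]

-- Near the base point the form `B` is invertible, so the field is `B⁻¹ v` and is differentiable.
-- The product rule applied to `B(z) X(z) = v`, with `B = id` at the base point, gives `DX = -(DB ·)
-- v`.
variable (E G) in
theorem hasFDerivAt_chartField (v : E) :
    HasFDerivAt (chartField E G v)
      (-(fderiv ℝ (chartForm E G) (extChartAt 𝓘(ℝ, E) (1 : G) 1)).flip v)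
      (extChartAt 𝓘(ℝ, E) (1 : G) 1) := by
  set e := extChartAt 𝓘(ℝ, E) (1 : G) 1 with he
  have hB := contDiffAt_chartForm E G
  have hinv : ContDiffAt ℝ ∞ ContinuousLinearMap.inverse (chartForm E G e) := by
    rw [chartForm_one]
    exact contDiffAt_map_inverse (ContinuousLinearEquiv.refl ℝ E)
  have hev : ∀ᶠ z in 𝓝 e, (chartForm E G z).IsInvertible := by
    refine hB.continuousAt.eventually ?_
    rw [← he, chartForm_one]
    exact (ContinuousLinearEquiv.refl ℝ E).nhds
  have hF : DifferentiableAt ℝ (chartField E G v) e := by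
    have h1 : DifferentiableAt ℝ (fun z => (chartForm E G z).inverse v) e :=
      ((hinv.comp e hB).differentiableAt (by simp)).clm_apply (differentiableAt_const v)
    refine h1.congr_of_eventuallyEq ?_
    filter_upwards [hev, chartForm_chartField E G v] with z hz hz'
    rw [← hz', hz.inverse_apply_self, hz']
  have hone : chartField E G v e = v := by
    have := (chartForm_chartField E G v).self_of_nhds
    rwa [chartForm_one] at this
  have hprod := (hB.differentiableAt (by simp)).hasFDerivAt.clm_apply hF.hasFDerivAt
  have hconst : HasFDerivAt (fun z => chartForm E G z (chartField E G v z)) (0 : E →L[ℝ] E) e :=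
    (hasFDerivAt_const v e).congr_of_eventuallyEq (chartForm_chartField E G v)
  have := hprod.unique hconst
  rw [← he, chartForm_one, hone, ContinuousLinearMap.id_comp] at this
  rw [← eq_neg_of_add_eq_zero_left this]
  exact hF.hasFDerivAt

variable (G) in
theorem ad_eq (v w : E) :
    ad G v w = fderiv ℝ (chartForm E G) (extChartAt 𝓘(ℝ, E) (1 : G) 1) w v -
      fderiv ℝ (chartForm E G) (extChartAt 𝓘(ℝ, E) (1 : G) 1) v w := by
  -- By definition the bracket on the Lie algebra is the bracket of the left-invariant fields in the
  -- chart at `1`, pulled back to the group.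
  have h0 : ad G v w =
      (mfderiv 𝓘(ℝ, E) 𝓘(ℝ, E) (extChartAt 𝓘(ℝ, E) (1 : G)) 1 : E →L[ℝ] E).inverse
      (lieBracketWithin (E := E) ℝ (chartField E G v) (chartField E G w)
        ((extChartAt 𝓘(ℝ, E) (1 : G)).symm ⁻¹' univ ∩ range 𝓘(ℝ, E))
        (extChartAt 𝓘(ℝ, E) (1 : G) 1)) := rfl
  have hone : ∀ v, chartField E G v (extChartAt 𝓘(ℝ, E) (1 : G) 1) = v := fun v => by
    have := (chartForm_chartField E G v).self_of_nhds
    rwa [chartForm_one] at this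
  have h1 : (mfderiv 𝓘(ℝ, E) 𝓘(ℝ, E) (extChartAt 𝓘(ℝ, E) (1 : G)) 1 : E →L[ℝ] E) =
      ContinuousLinearMap.id ℝ E := mfderiv_extChartAt_self
  have h2 : (mfderiv 𝓘(ℝ, E) 𝓘(ℝ, E) (extChartAt 𝓘(ℝ, E) (1 : G)) 1 : E →L[ℝ] E).inverse =
      ContinuousLinearMap.id ℝ E :=
    (congrArg (ContinuousLinearMap.inverse (R := ℝ) (M := E) (M₂ := E)) h1).trans
      ContinuousLinearMap.inverse_id
  rw [h0]
  refine (congrArg (fun A : E →L[ℝ] E => A _) h2).trans ?_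
  rw [ContinuousLinearMap.id_apply, preimage_univ, univ_inter, ModelWithCorners.range_eq_univ,
    lieBracketWithin_univ, lieBracket_eq]
  simp only [(hasFDerivAt_chartField E G _).fderiv, hone]
  simp [sub_eq_add_neg, add_comm]

/-- By left invariance the form may be computed after translating by `(Γ x)⁻¹`. In the chart it is
then `B(c y) ∘ Dc(y)`, with `B = id` at `c x`. In the antisymmetrised derivative the symmetric `D²c`
cancels, and what remains of `DB` is the bracket by `ad_eq`. -/
theorem fderiv_maurerCartan {Γ : X → G} {x : X} (hΓ : ContMDiffAt 𝓘(ℝ, X) 𝓘(ℝ, E) ∞ Γ x)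
    (w₁ w₂ : X) :
    fderiv ℝ (maurerCartan E Γ) x w₁ w₂ - fderiv ℝ (maurerCartan E Γ) x w₂ w₁ =
      ad G (maurerCartan E Γ x w₂) (maurerCartan E Γ x w₁) := by
  set e := extChartAt 𝓘(ℝ, E) (1 : G) 1 with he
  set c : X → E := fun y => extChartAt 𝓘(ℝ, E) (1 : G) ((Γ x)⁻¹ * Γ y) with hc
  have hcx : c x = e := by simp [hc, he]
  have hm : ContMDiffAt 𝓘(ℝ, X) 𝓘(ℝ, E) ∞ (fun y => (Γ x)⁻¹ * Γ y) x :=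
    contMDiffAt_const.mul hΓ
  have hcs : ContDiffAt ℝ ∞ c x := by
    have h2 : ContMDiffAt 𝓘(ℝ, E) 𝓘(ℝ, E) ∞ (extChartAt 𝓘(ℝ, E) (1 : G)) ((Γ x)⁻¹ * Γ x) := by
      rw [inv_mul_cancel]
      exact contMDiffAt_extChartAt
    exact (ContMDiffAt.comp x h2 hm).contDiffAt
  have hsrc : ∀ᶠ y in 𝓝 x, (Γ x)⁻¹ * Γ y ∈ (extChartAt 𝓘(ℝ, E) (1 : G)).source := by
    refine hm.continuousAt.eventually ?_
    change ∀ᶠ k in 𝓝 ((Γ x)⁻¹ * Γ x), k ∈ (extChartAt 𝓘(ℝ, E) (1 : G)).source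
    rw [inv_mul_cancel]
    exact extChartAt_source_mem_nhds (1 : G)
  have hcd : ∀ᶠ y in 𝓝 x, DifferentiableAt ℝ c y := by
    filter_upwards [(contDiffAt_infty.1 hcs 1).eventually (by simp)] with y hy
    exact hy.differentiableAt (by simp)
  have hq := (eventually_contMDiffAt_extChartAt_symm E G)
  rw [← he, ← hcx] at hq
  have hloc : maurerCartan E Γ =ᶠ[𝓝 x] fun y => (chartForm E G (c y)).comp (fderiv ℝ c y) := by
    filter_upwards [hsrc.eventually_nhds, hcd, hcs.continuousAt.eventually hq] with y hy hyd hyq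
    have hq2 : DifferentiableAt ℝ (fun z => extChartAt 𝓘(ℝ, E) (1 : G)
        (((extChartAt 𝓘(ℝ, E) (1 : G)).symm (c y))⁻¹ *
          (extChartAt 𝓘(ℝ, E) (1 : G)).symm z)) (c y) :=
      ((contDiffAt_extChartAt_inv_mul hyq).comp (f := fun z => (c y, z)) (c y)
        (contDiffAt_const.prodMk contDiffAt_id)).differentiableAt (by simp)
    rw [chartForm, maurerCartan, maurerCartan, ← fderiv_comp y hq2 hyd]
    refine Filter.EventuallyEq.fderiv_eq ?_
    filter_upwards [hy] with z hz
    simp only [Function.comp_apply, hc]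
    rw [PartialEquiv.left_inv _ hy.self_of_nhds, PartialEquiv.left_inv _ hz]
    group
  have hBd : HasFDerivAt (chartForm E G) (fderiv ℝ (chartForm E G) e) (c x) := by
    rw [hcx]
    exact ((contDiffAt_chartForm E G).differentiableAt (by simp)).hasFDerivAt
  have hc1 : HasFDerivAt c (fderiv ℝ c x) x := hcd.self_of_nhds.hasFDerivAt
  have hc2 : HasFDerivAt (fderiv ℝ c) (fderiv ℝ (fderiv ℝ c) x) x :=
    (((contDiffAt_infty.1 hcs 2).fderiv_right (m := 1) (by norm_num)).differentiableAt (by simp)).hasFDerivAt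
  have hd := ((hBd.comp x hc1).clm_comp hc2).congr_of_eventuallyEq hloc
  have hsym : fderiv ℝ (fderiv ℝ c) x w₁ w₂ = fderiv ℝ (fderiv ℝ c) x w₂ w₁ :=
    ((contDiffAt_infty.1 hcs 2).isSymmSndFDerivAt (by simp)).eq w₁ w₂
  have hx : maurerCartan E Γ x = fderiv ℝ c x := rfl
  rw [hd.fderiv, ad_eq, hx, ← he]
  simp [hcx, hsym]

end MaurerCartan

/-! ### Left-trivialised velocities of curves and of families of curves. -/

section Curves

variable {E : Type*} [NormedAddCommGroup E] [NormedSpace ℝ E]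
  {G : Type*} [TopologicalSpace G] [ChartedSpace E G] [Group G]
  {X : Type*} [NormedAddCommGroup X] [NormedSpace ℝ X]

variable (E G) in
/-- The Lie bracket as a continuous bilinear map. -/
def adL : E →L[ℝ] E →L[ℝ] E :=
  (fderiv ℝ (chartForm E G) (extChartAt 𝓘(ℝ, E) (1 : G) 1)).flip -
    fderiv ℝ (chartForm E G) (extChartAt 𝓘(ℝ, E) (1 : G) 1)

theorem maurerCartan_const_mul (p : G) (Γ : X → G) :
    maurerCartan E (fun x => p * Γ x) = maurerCartan E Γ := by
  funext x
  have : ∀ y, (p * Γ x)⁻¹ * (p * Γ y) = (Γ x)⁻¹ * Γ y := fun y => by group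
  simp only [maurerCartan, this]

-- Stated for points of `TG`, since velocities over different base points lie in different tangent
-- spaces; `g⁻¹ġ` is a function of such a point.
variable (E) in
theorem leftVelocity_eq_of_tangentLift_eq {g h : ℝ → G} {s t : ℝ}
    (H : tangentLift E g s = tangentLift E h t) :
    leftVelocity (E := E) g s = leftVelocity h t :=
  congrArg (fun q : TangentBundle 𝓘(ℝ, E) G =>
    (mfderiv 𝓘(ℝ, E) 𝓘(ℝ, E) (fun k : G => q.1⁻¹ * k) q.1 q.2 : E)) H

theorem leftVelocity_eq_zero_of_velocity {g : ℝ → G} {t : ℝ} (h : velocity E g t = 0) :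
    leftVelocity (E := E) g t = 0 := by
  rw [leftVelocity, h]
  exact map_zero (mfderiv 𝓘(ℝ, E) 𝓘(ℝ, E) (fun k : G => (g t)⁻¹ * k) (g t))

omit [Group G] in
variable (E) in
theorem velocity_const (p : G) (t : ℝ) : velocity E (fun _ => p) t = 0 := by
  rw [velocity, mfderiv_const]
  rfl

-- The point `p` is kept apart from `c t`, so that lifts of two curves through `p` can be compared
-- without transport.
omit [Group G] in
theorem tangentLift_comp {Γ : X → G} {c : ℝ → X} {t : ℝ} {p : X} (hp : c t = p)
    (hΓ : MDifferentiableAt 𝓘(ℝ, X) 𝓘(ℝ, E) Γ p) {c' : X} (hc : HasDerivAt c c' t) :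
    tangentLift E (fun s => Γ (c s)) t = ⟨Γ p, mfderiv 𝓘(ℝ, X) 𝓘(ℝ, E) Γ p c'⟩ := by
  subst hp
  rw [tangentLift, velocity_comp hΓ hc]

variable [LieGroup 𝓘(ℝ, E) ∞ G]

theorem adL_apply [CompleteSpace E] (v w : E) : adL E G v w = ad G v w := by
  rw [ad_eq, adL]
  simp

theorem velocity_eq_mulInvariantVectorField_iff [FiniteDimensional ℝ E] {g : ℝ → G} {t : ℝ}
    {v : E} : velocity E g t = mulInvariantVectorField (I := 𝓘(ℝ, E)) (G := G) v (g t) ↔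
      leftVelocity g t = v := by
  set T : E →L[ℝ] E := mfderiv 𝓘(ℝ, E) 𝓘(ℝ, E) (fun k : G => (g t)⁻¹ * k) (g t) with hT
  have hTv : ∀ v : E, T (mulInvariantVectorField (I := 𝓘(ℝ, E)) (G := G) v (g t)) = v :=
    mfderiv_inv_mul_mulInvariantVectorField (g t)
  -- The translation derivative is onto because it hits every `v`; in finite dimension it is then
  -- one-to-one.
  have hinj : Function.Injective (T : E →ₗ[ℝ] E) :=
    LinearMap.injective_iff_surjective.2 fun v => ⟨_, hTv v⟩
  have hl : leftVelocity g t = T (velocity E g t) := rfl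
  constructor
  · intro h
    rw [hl, h, hTv]
  · intro h
    refine hinj ?_
    exact (hl.symm.trans h).trans (hTv v).symm

theorem leftVelocity_eq_maurerCartan {g : ℝ → G} (hg : ContMDiff 𝓘(ℝ, ℝ) 𝓘(ℝ, E) ∞ g) (t : ℝ) :
    leftVelocity (E := E) g t = maurerCartan E g t 1 :=
  leftVelocity_comp (c := id) (hg.mdifferentiable (by simp) t) (hasDerivAt_id t)

theorem contDiff_leftVelocity {g : ℝ → G} (hg : ContMDiff 𝓘(ℝ, ℝ) 𝓘(ℝ, E) ∞ g) :
    ContDiff ℝ ∞ (leftVelocity (E := E) g) := by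
  rw [funext (leftVelocity_eq_maurerCartan hg)]
  exact (contDiff_maurerCartan hg).clm_apply contDiff_const

theorem leftVelocity_shift (g : SmoothCurve 𝓘(ℝ, E) G) (t s : ℝ) :
    leftVelocity (E := E) (shift g t) s = leftVelocity g (t + s) := by
  rw [leftVelocity_eq_maurerCartan g.contMDiff]
  exact leftVelocity_comp (c := fun s => t + s) (g.contMDiff.mdifferentiable (by simp) _)
    ((hasDerivAt_id s).const_add t)

/-- The jet at `t` is the class of a time-shifted curve, and the left velocity commutes with time
shifts. -/
theorem lagrangian_jet {L : HigherTangentBundle E G 2 → ℝ} {ℓ : E × E → ℝ}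
    (hL : IsReducedLagrangian L ℓ) (g : SmoothCurve 𝓘(ℝ, E) G) (t : ℝ) :
    L (jet 2 g t) = ℓ (leftVelocity g t, deriv (leftVelocity g) t) := by
  have h : leftVelocity (E := E) (shift g t) = fun s => leftVelocity g (t + s) :=
    funext fun s => leftVelocity_shift g t s
  rw [jet, hL (shift g t), h, deriv_comp_const_add]
  simp

theorem action_eq_reducedAction {L : HigherTangentBundle E G 2 → ℝ} {ℓ : E × E → ℝ}
    (hL : IsReducedLagrangian L ℓ) (a : ℝ) (g : SmoothCurve 𝓘(ℝ, E) G) :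
    action a L g = reducedAction a ℓ (leftVelocity g) := by
  simp only [action, reducedAction, lagrangian_jet hL]

/-! ### Two-parameter families -/

section Family

variable {Γ : ℝ × ℝ → G}

theorem leftVelocity_snd (hΓ : ContMDiff 𝓘(ℝ, ℝ × ℝ) 𝓘(ℝ, E) ∞ Γ) (ε t : ℝ) :
    leftVelocity (E := E) (fun s => Γ (ε, s)) t = maurerCartan E Γ (ε, t) (0, 1) :=
  leftVelocity_comp (c := fun s => (ε, s)) (hΓ.mdifferentiable (by simp) _)
    ((hasDerivAt_const t ε).prodMk (hasDerivAt_id t))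

theorem leftVelocity_fst (hΓ : ContMDiff 𝓘(ℝ, ℝ × ℝ) 𝓘(ℝ, E) ∞ Γ) (ε t : ℝ) :
    leftVelocity (E := E) (fun s => Γ (s, t)) ε = maurerCartan E Γ (ε, t) (1, 0) :=
  leftVelocity_comp (c := fun s => (s, t)) (hΓ.mdifferentiable (by simp) _)
    ((hasDerivAt_id ε).prodMk (hasDerivAt_const ε t))

theorem contDiff_leftVelocity_snd (hΓ : ContMDiff 𝓘(ℝ, ℝ × ℝ) 𝓘(ℝ, E) ∞ Γ) :
    ContDiff ℝ ∞ (fun p : ℝ × ℝ => leftVelocity (E := E) (fun s => Γ (p.1, s)) p.2) := by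
  simp only [leftVelocity_snd hΓ]
  exact (contDiff_maurerCartan hΓ).clm_apply contDiff_const

theorem contDiff_leftVelocity_fst (hΓ : ContMDiff 𝓘(ℝ, ℝ × ℝ) 𝓘(ℝ, E) ∞ Γ) (ε : ℝ) :
    ContDiff ℝ ∞ (fun t : ℝ => leftVelocity (E := E) (fun s => Γ (s, t)) ε) := by
  simp only [leftVelocity_fst hΓ]
  exact ((contDiff_maurerCartan hΓ).comp (contDiff_const.prodMk contDiff_id)).clm_apply
    contDiff_const

/-- The variation of `v = g⁻¹ ġ` is `δv = η̇ + ad_v η` with `η = g⁻¹ δg`. -/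
theorem hasDerivAt_leftVelocity_variation [CompleteSpace E]
    (hΓ : ContMDiff 𝓘(ℝ, ℝ × ℝ) 𝓘(ℝ, E) ∞ Γ) (ε t : ℝ) :
    HasDerivAt (fun ε => leftVelocity (E := E) (fun s => Γ (ε, s)) t)
      (deriv (fun t => leftVelocity (E := E) (fun s => Γ (s, t)) ε) t +
        ad G (leftVelocity (E := E) (fun s => Γ (ε, s)) t)
          (leftVelocity (E := E) (fun s => Γ (s, t)) ε)) ε := by
  simp only [leftVelocity_snd hΓ, leftVelocity_fst hΓ]
  have hd := ((contDiff_maurerCartan hΓ).differentiable (by simp) (ε, t)).hasFDerivAt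
  have hdw : ∀ w : ℝ × ℝ, HasFDerivAt (fun p => maurerCartan E Γ p w)
      ((fderiv ℝ (maurerCartan E Γ) (ε, t)).flip w) (ε, t) := fun w =>
    (hd.clm_apply (hasFDerivAt_const w (ε, t))).congr_fderiv (by ext <;> simp)
  have h1 := (hdw (0, 1)).comp_hasDerivAt ε ((hasDerivAt_id ε).prodMk (hasDerivAt_const ε t))
  have h2 := (hdw (1, 0)).comp_hasDerivAt t ((hasDerivAt_const t ε).prodMk (hasDerivAt_id t))
  have h2' : deriv (fun t => maurerCartan E Γ (ε, t) (1, 0)) t =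
      fderiv ℝ (maurerCartan E Γ) (ε, t) (0, 1) (1, 0) := h2.deriv
  -- The structure equation exchanges the two mixed derivatives at the cost of the bracket term.
  rw [h2', ← fderiv_maurerCartan (hΓ (ε, t)), add_sub_cancel]
  exact h1

end Family

/-! ### A deformation with prescribed variation -/

variable [FiniteDimensional ℝ E]

variable (E G) in
/-- A substitute for the exponential map. -/
theorem exists_smooth_retraction : ∃ σ : E → G, ContMDiff 𝓘(ℝ, E) 𝓘(ℝ, E) ∞ σ ∧ σ 0 = 1 ∧
    maurerCartan E σ 0 = ContinuousLinearMap.id ℝ E := by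
  set e := extChartAt 𝓘(ℝ, E) (1 : G) 1 with he
  obtain ⟨r, hr, hball⟩ := Metric.mem_nhds_iff.1
    (extChartAt_target_mem_nhds (I := 𝓘(ℝ, E)) (1 : G))
  -- The outer radius `r` is that of a ball inside the chart target, so `e + f x • x` never leaves
  -- the target and the inverse chart gives a map smooth on all of `E`. As `f = 1` near `0`, the map
  -- is the inverse chart there.
  let f : ContDiffBump (0 : E) := ⟨r / 2, r, by positivity, by linarith⟩
  have hmem : ∀ x, e + f x • x ∈ (extChartAt 𝓘(ℝ, E) (1 : G)).target := by
    intro x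
    refine hball ?_
    rw [mem_ball_iff_norm, ← he, add_sub_cancel_left]
    by_cases hx : ‖x‖ < r
    · rw [norm_smul, Real.norm_of_nonneg f.nonneg]
      exact (mul_le_of_le_one_left (norm_nonneg x) f.le_one).trans_lt hx
    · rw [f.zero_of_le_dist (by simpa [f] using hx)]
      simpa using hr
  have hs : ContDiff ℝ ∞ fun x => e + f x • x := contDiff_const.add (f.contDiff.smul contDiff_id)
  refine ⟨fun x => (extChartAt 𝓘(ℝ, E) (1 : G)).symm (e + f x • x), ?_, ?_, ?_⟩
  · exact (contMDiffOn_extChartAt_symm (1 : G)).comp_contMDiff hs.contMDiff hmem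
  · simp only [smul_zero, add_zero, he, extChartAt_to_inv]
  · have h0 : (extChartAt 𝓘(ℝ, E) (1 : G)).symm (e + f 0 • (0 : E)) = 1 := by
      simp only [smul_zero, add_zero, he, extChartAt_to_inv]
    have : (fun y => extChartAt 𝓘(ℝ, E) (1 : G)
        (((extChartAt 𝓘(ℝ, E) (1 : G)).symm (e + f 0 • (0 : E)))⁻¹ *
          (extChartAt 𝓘(ℝ, E) (1 : G)).symm (e + f y • y))) =ᶠ[𝓝 0] fun y => e + y := by
      filter_upwards [f.eventuallyEq_one] with y hy
      rw [h0, inv_one, one_mul, PartialEquiv.right_inv _ (hmem y), hy, Pi.one_apply, one_smul]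
    rw [maurerCartan, this.fderiv_eq, fderiv_const_add, fderiv_fun_id]

/-- Every `η` is the left-trivialised variation of a deformation of `g`. -/
theorem exists_deformation (g : SmoothCurve 𝓘(ℝ, E) G) {η : ℝ → E} (hη : ContDiff ℝ ∞ η) :
    ∃ Γ : ℝ → SmoothCurve 𝓘(ℝ, E) G,
      ContMDiff 𝓘(ℝ, ℝ × ℝ) 𝓘(ℝ, E) ∞ (fun p : ℝ × ℝ => Γ p.1 p.2) ∧
      (∀ t, Γ 0 t = g t) ∧
      (∀ t, leftVelocity (E := E) (fun ε => Γ ε t) 0 = η t) ∧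
      (∀ t, η t = 0 → ∀ ε, Γ ε t = g t) ∧
      ∀ t, η t = 0 → deriv η t = 0 → ∀ ε, tangentLift E (Γ ε) t = tangentLift E g t := by
  obtain ⟨σ, hσ, h0, h1⟩ := exists_smooth_retraction E G
  have hF : ContMDiff 𝓘(ℝ, ℝ × E) 𝓘(ℝ, E) ∞ (fun q : ℝ × E => g q.1 * σ q.2) :=
    (g.contMDiff.comp contDiff_fst.contMDiff).mul (hσ.comp contDiff_snd.contMDiff)
  have hΓ : ContMDiff 𝓘(ℝ, ℝ × ℝ) 𝓘(ℝ, E) ∞ (fun p : ℝ × ℝ => g p.2 * σ (p.1 • η p.2)) :=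
    hF.comp (contDiff_snd.prodMk (contDiff_fst.smul (hη.comp contDiff_snd))).contMDiff
  refine ⟨fun ε => ⟨fun t => g t * σ (ε • η t),
    hΓ.comp (contDiff_const.prodMk contDiff_id).contMDiff⟩, hΓ, ?_, ?_, ?_, ?_⟩
  · intro t
    change g t * σ ((0 : ℝ) • η t) = g t
    rw [zero_smul, h0, mul_one]
  · intro t
    have hc : HasDerivAt (fun ε : ℝ => ε • η t) (η t) 0 := by
      simpa using (hasDerivAt_id (0 : ℝ)).smul_const (η t)
    have hm : ContMDiff 𝓘(ℝ, E) 𝓘(ℝ, E) ∞ fun x => g t * σ x := contMDiff_const.mul hσ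
    refine (leftVelocity_comp (Γ := fun x => g t * σ x) (hm.mdifferentiable (by simp) _) hc).trans ?_
    rw [maurerCartan_const_mul, zero_smul, h1, ContinuousLinearMap.id_apply]
  · intro t ht ε
    change g t * σ (ε • η t) = g t
    rw [ht, smul_zero, h0, mul_one]
  · intro t ht ht' ε
    have hηt : HasDerivAt η 0 t := ht' ▸ (hη.differentiable (by simp) t).hasDerivAt
    have hFm := hF.mdifferentiable (by simp) (t, (0 : E))
    -- When `η` and its derivative vanish at `t`, the curves `s ↦ (s, ε • η s)` and `s ↦ (s, 0)`
    -- have the same position and velocity at `t`.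
    have e1 := tangentLift_comp (c := fun s => (s, ε • η s)) (t := t) (by simp [ht]) hFm
      ((hasDerivAt_id t).prodMk (hηt.const_smul ε))
    have e2 := tangentLift_comp (c := fun s => (s, (0 : E))) (t := t) rfl hFm
      ((hasDerivAt_id t).prodMk (hasDerivAt_const t (0 : E)))
    rw [smul_zero] at e1
    simp only [h0, mul_one] at e1 e2
    exact e1.trans e2.symm

end Curves

/-! ### Differentiation under the integral sign and the fundamental lemma. -/

section Calculus

variable {F : Type*} [NormedAddCommGroup F] [NormedSpace ℝ F]

/-- Curves are compared only on `[0, a]`, so their derivatives are known to agree only in the open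
interval; the endpoints are null. -/
theorem integral_congr_Ioo {a : ℝ} (ha : 0 < a) {f g : ℝ → ℝ} (h : ∀ t ∈ Ioo 0 a, f t = g t) :
    ∫ t in (0 : ℝ)..a, f t = ∫ t in (0 : ℝ)..a, g t := by
  rw [intervalIntegral.integral_of_le ha.le, intervalIntegral.integral_of_le ha.le,
    integral_Ioc_eq_integral_Ioo, integral_Ioc_eq_integral_Ioo]
  exact setIntegral_congr_fun measurableSet_Ioo h

theorem hasDerivAt_fst {W : ℝ × ℝ → F} (hW : ContDiff ℝ ∞ W) (ε t : ℝ) :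
    HasDerivAt (fun ε => W (ε, t)) (fderiv ℝ W (ε, t) (1, 0)) ε :=
  (hW.differentiable (by simp) (ε, t)).hasFDerivAt.comp_hasDerivAt ε
    ((hasDerivAt_id ε).prodMk (hasDerivAt_const ε t))

theorem hasDerivAt_snd {W : ℝ × ℝ → F} (hW : ContDiff ℝ ∞ W) (ε t : ℝ) :
    HasDerivAt (fun s => W (ε, s)) (fderiv ℝ W (ε, t) (0, 1)) t :=
  (hW.differentiable (by simp) (ε, t)).hasFDerivAt.comp_hasDerivAt t
    ((hasDerivAt_const t ε).prodMk (hasDerivAt_id t))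

theorem contDiff_fderiv_apply {W : ℝ × ℝ → F} (hW : ContDiff ℝ ∞ W) (w : ℝ × ℝ) :
    ContDiff ℝ ∞ (fun p => fderiv ℝ W p w) :=
  (hW.fderiv_right (m := ∞) (by simp)).clm_apply contDiff_const

theorem contDiff_deriv_snd {W : ℝ × ℝ → F} (hW : ContDiff ℝ ∞ W) :
    ContDiff ℝ ∞ (fun p : ℝ × ℝ => deriv (fun s => W (p.1, s)) p.2) := by
  have : (fun p : ℝ × ℝ => deriv (fun s => W (p.1, s)) p.2) = fun p => fderiv ℝ W p (0, 1) :=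
    funext fun p => (hasDerivAt_snd hW p.1 p.2).deriv
  rw [this]
  exact contDiff_fderiv_apply hW _

theorem contDiff_deriv {f : ℝ → F} (hf : ContDiff ℝ ∞ f) : ContDiff ℝ ∞ (deriv f) :=
  (contDiff_infty_iff_deriv.1 hf).2

theorem hasDerivAt_deriv {f : ℝ → F} (hf : ContDiff ℝ ∞ f) (t : ℝ) : HasDerivAt f (deriv f t) t :=
  (hf.differentiable (by simp) t).hasDerivAt

/-- Mixed partial derivatives commute. -/
theorem hasDerivAt_deriv_snd {W : ℝ × ℝ → F} (hW : ContDiff ℝ ∞ W) (ε t : ℝ) :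
    HasDerivAt (fun ε => deriv (fun s => W (ε, s)) t)
      (deriv (fun s => deriv (fun ε => W (ε, s)) ε) t) ε := by
  have e1 : (fun ε => deriv (fun s => W (ε, s)) t) = fun ε => fderiv ℝ W (ε, t) (0, 1) :=
    funext fun ε => (hasDerivAt_snd hW ε t).deriv
  have e2 : (fun s => deriv (fun ε => W (ε, s)) ε) = fun s => fderiv ℝ W (ε, s) (1, 0) :=
    funext fun s => (hasDerivAt_fst hW ε s).deriv
  have hd := ((hW.fderiv_right (m := ∞) (by simp)).differentiable (by simp) (ε, t)).hasFDerivAt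
  have hdw : ∀ w w' : ℝ × ℝ, fderiv ℝ (fun p => fderiv ℝ W p w) (ε, t) w' =
      fderiv ℝ (fderiv ℝ W) (ε, t) w' w := fun w w' => by
    rw [(hd.clm_apply (hasFDerivAt_const w (ε, t))).fderiv]
    simp
  rw [e1, e2, (hasDerivAt_snd (contDiff_fderiv_apply hW (1, 0)) ε t).deriv, hdw,
    ← ((contDiff_infty.1 hW 2).contDiffAt.isSymmSndFDerivAt (by simp)).eq, ← hdw]
  exact hasDerivAt_fst (contDiff_fderiv_apply hW (0, 1)) ε t

/-- Differentiation under the integral sign for smooth integrands. -/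
theorem hasDerivAt_integral_of_contDiff {a : ℝ} (ha : 0 < a) {W : ℝ × ℝ → ℝ}
    (hW : ContDiff ℝ ∞ W) {W' : ℝ → ℝ}
    (h : ∀ t ∈ Ioo 0 a, HasDerivAt (fun ε => W (ε, t)) (W' t) 0) :
    HasDerivAt (fun ε => ∫ t in (0 : ℝ)..a, W (ε, t)) (∫ t in (0 : ℝ)..a, W' t) 0 := by
  have hc : Continuous fun p => fderiv ℝ W p (1, 0) := (contDiff_fderiv_apply hW _).continuous
  have e : ∫ t in (0 : ℝ)..a, W' t = ∫ t in (0 : ℝ)..a, fderiv ℝ W (0, t) (1, 0) :=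
    integral_congr_Ioo ha fun t ht => (h t ht).unique (hasDerivAt_fst hW 0 t)
  rw [e]
  obtain ⟨C, hC⟩ := ((isCompact_closedBall (0 : ℝ) 1).prod
    (isCompact_Icc (a := (0 : ℝ)) (b := a))).exists_bound_of_continuousOn hc.continuousOn
  refine (intervalIntegral.hasDerivAt_integral_of_dominated_loc_of_deriv_le
    (F := fun ε t => W (ε, t)) (F' := fun ε t => fderiv ℝ W (ε, t) (1, 0)) (bound := fun _ => C)
    (Metric.closedBall_mem_nhds (0 : ℝ) one_pos) ?_ ?_ ?_ ?_ ?_ ?_).2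
  · exact Eventually.of_forall fun ε =>
      (hW.continuous.comp (Continuous.prodMk_right ε)).aestronglyMeasurable
  · exact (hW.continuous.comp (Continuous.prodMk_right 0)).intervalIntegrable _ _
  · exact (hc.comp (Continuous.prodMk_right 0)).aestronglyMeasurable
  · refine Eventually.of_forall fun t ht ε hε => hC (ε, t) ⟨hε, ?_⟩
    rw [uIoc_of_le ha.le] at ht
    exact Ioc_subset_Icc_self ht
  · exact intervalIntegrable_const
  · exact Eventually.of_forall fun t _ ε _ => hasDerivAt_fst hW ε t

/-- The fundamental lemma of the calculus of variations. -/
theorem eq_zero_of_integral_mul_eq_zero {a : ℝ} (ha : 0 < a) {f : ℝ → ℝ} (hf : Continuous f)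
    (h : ∀ φ : ℝ → ℝ, ContDiff ℝ ∞ φ → φ 0 = 0 → φ a = 0 → deriv φ 0 = 0 → deriv φ a = 0 →
      ∫ t in (0 : ℝ)..a, φ t * f t = 0) : ∀ t ∈ Icc 0 a, f t = 0 := by
  -- Test functions compactly supported in `(0, a)` meet all four endpoint conditions and already
  -- suffice; continuity then extends the conclusion to `[0, a]`.
  have hae : ∀ᵐ t, t ∈ Ioo 0 a → f t = 0 := by
    refine isOpen_Ioo.ae_eq_zero_of_integral_contDiff_smul_eq_zero
      (hf.locallyIntegrable.locallyIntegrableOn _) fun φ hφ _ hs => ?_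
    have hz : ∀ x, x ∉ Ioo 0 a → φ x = 0 ∧ deriv φ x = 0 := fun x hx => by
      have hev := notMem_tsupport_iff_eventuallyEq.1 fun hx' => hx (hs hx')
      refine ⟨hev.self_of_nhds, ?_⟩
      rw [hev.deriv_eq]
      exact deriv_const x 0
    have h0 := hz 0 (by simp)
    have h1 := hz a (by simp)
    rw [← h φ hφ h0.1 h1.1 h0.2 h1.2, intervalIntegral.integral_of_le ha.le,
      integral_Ioc_eq_integral_Ioo]
    refine (setIntegral_eq_integral_of_forall_compl_eq_zero fun x hx => ?_).symm
    simp [(hz x hx).1]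
  have hIoo : EqOn f 0 (Ioo 0 a) := by
    refine Measure.eqOn_open_of_ae_eq (μ := volume) ?_ isOpen_Ioo hf.continuousOn
      continuousOn_const
    exact (ae_restrict_iff' measurableSet_Ioo).2 hae
  have := hIoo.closure hf continuous_const
  rwa [closure_Ioo ha.ne] at this

theorem integral_add_deriv_eq {a : ℝ} {f h : ℝ → ℝ} (hf : Continuous f) (hh : ContDiff ℝ ∞ h)
    (h0 : h 0 = 0) (h1 : h a = 0) :
    ∫ t in (0 : ℝ)..a, (f t + deriv h t) = ∫ t in (0 : ℝ)..a, f t := by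
  have hc := (contDiff_deriv hh).continuous
  rw [intervalIntegral.integral_add (hf.intervalIntegrable _ _) (hc.intervalIntegrable _ _),
    intervalIntegral.integral_deriv_eq_sub (fun t _ => hh.differentiable (by simp) t)
      (hc.intervalIntegrable _ _), h0, h1]
  simp

end Calculus

/-! ### First variation of the reduced action. -/

section Reduced

variable {E : Type*} [NormedAddCommGroup E] [NormedSpace ℝ E]

theorem fderiv_partial_fst {ℓ : E × E → ℝ} (hℓ : ContDiff ℝ ∞ ℓ) (x w : E) :
    fderiv ℝ (fun x => ℓ (x, w)) x = (fderiv ℝ ℓ (x, w)).comp (.inl ℝ E E) :=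
  ((hℓ.differentiable (by simp) (x, w)).hasFDerivAt.comp x (hasFDerivAt_prodMk_left x w)).fderiv

theorem fderiv_partial_snd {ℓ : E × E → ℝ} (hℓ : ContDiff ℝ ∞ ℓ) (x w : E) :
    fderiv ℝ (fun w => ℓ (x, w)) w = (fderiv ℝ ℓ (x, w)).comp (.inr ℝ E E) :=
  ((hℓ.differentiable (by simp) (x, w)).hasFDerivAt.comp w (hasFDerivAt_prodMk_right x w)).fderiv

theorem hasDerivAt_reducedAction {a : ℝ} (ha : 0 < a) {ℓ : E × E → ℝ} (hℓ : ContDiff ℝ ∞ ℓ)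
    {W : ℝ × ℝ → E} (hW : ContDiff ℝ ∞ W) {v w : ℝ → E}
    (hv : ∀ t ∈ Ioo 0 a, W (0, t) = v t)
    (hw : ∀ t ∈ Ioo 0 a, HasDerivAt (fun ε => W (ε, t)) (w t) 0) :
    HasDerivAt (fun ε => reducedAction a ℓ (fun t => W (ε, t)))
      (∫ t in (0 : ℝ)..a, fderiv ℝ ℓ (v t, deriv v t) (w t, deriv w t)) 0 := by
  refine hasDerivAt_integral_of_contDiff ha
    (W := fun p => ℓ (W p, deriv (fun s => W (p.1, s)) p.2))
    (hℓ.comp (hW.prodMk (contDiff_deriv_snd hW))) fun t ht => ?_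
  have hv' : deriv (fun s => W (0, s)) t = deriv v t :=
    EventuallyEq.deriv_eq (by filter_upwards [Ioo_mem_nhds ht.1 ht.2] with s hs using hv s hs)
  have hw' : deriv (fun s => deriv (fun ε => W (ε, s)) 0) t = deriv w t :=
    EventuallyEq.deriv_eq
      (by filter_upwards [Ioo_mem_nhds ht.1 ht.2] with s hs using (hw s hs).deriv)
  have h2 := hasDerivAt_deriv_snd hW 0 t
  rw [hw'] at h2
  have h1 := (hℓ.differentiable (by simp) (W (0, t), deriv (fun s => W (0, s)) t)).hasFDerivAt
  have h3 := h1.comp_hasDerivAt (0 : ℝ) ((hw t ht).prodMk h2)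
  rwa [hv', hv t ht] at h3

end Reduced

/-! ### Hamilton's principles and the Euler–Poincaré equations. -/

section Stationarity

variable {E : Type*} [NormedAddCommGroup E] [NormedSpace ℝ E]
  {G : Type*} [TopologicalSpace G] [ChartedSpace E G] [Group G]

variable (G) in
/-- Vanishing of the first variation of `∫ ℓ(v, v̇) dt` along `δv = η̇ + ad_v η`. -/
def IsReducedCritical (a : ℝ) (ℓ : E × E → ℝ) (v : ℝ → E) : Prop :=
  ∀ η : ℝ → E, ContDiff ℝ ∞ η → η 0 = 0 → η a = 0 → deriv η 0 = 0 → deriv η a = 0 →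
    ∫ t in (0 : ℝ)..a, fderiv ℝ ℓ (v t, deriv v t)
      (deriv η t + ad G (v t) (η t), deriv (fun s => deriv η s + ad G (v s) (η s)) t) = 0

/-- The curve `(g, ξ, u, μ, ν)` with `c = (ξ, u, μ, ν)`. -/
def mkPontryaginCurve (g : SmoothCurve 𝓘(ℝ, E) G)
    (c : ℝ → E × E × StrongDual ℝ E × StrongDual ℝ E) (hc : ContDiff ℝ ∞ c) :
    PontryaginCurve E G :=
  ⟨fun t => (g t, c t), g.contMDiff.prodMk hc.contMDiff⟩

section Components

variable {X : Type*} [NormedAddCommGroup X] [NormedSpace ℝ X] {f : X → PontryaginBundle E G}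

omit [Group G] in
theorem contMDiff_base (hf : ContMDiff 𝓘(ℝ, X) (pontryaginModel E) ∞ f) :
    ContMDiff 𝓘(ℝ, X) 𝓘(ℝ, E) ∞ (fun x => (f x).g) :=
  contMDiff_fst.comp hf

omit [Group G] in
theorem contDiff_fiber (hf : ContMDiff 𝓘(ℝ, X) (pontryaginModel E) ∞ f) :
    ContDiff ℝ ∞ (fun x => (f x).2) :=
  (contMDiff_snd.comp hf).contDiff

omit [Group G] in
theorem contDiff_xi (hf : ContMDiff 𝓘(ℝ, X) (pontryaginModel E) ∞ f) :
    ContDiff ℝ ∞ (fun x => (f x).ξ) :=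
  (contDiff_fiber hf).fst

omit [Group G] in
theorem contDiff_u (hf : ContMDiff 𝓘(ℝ, X) (pontryaginModel E) ∞ f) :
    ContDiff ℝ ∞ (fun x => (f x).u) :=
  (contDiff_fiber hf).snd.fst

omit [Group G] in
theorem contDiff_mu (hf : ContMDiff 𝓘(ℝ, X) (pontryaginModel E) ∞ f) :
    ContDiff ℝ ∞ (fun x => (f x).μ) :=
  (contDiff_fiber hf).snd.snd.fst

omit [Group G] in
theorem contDiff_nu (hf : ContMDiff 𝓘(ℝ, X) (pontryaginModel E) ∞ f) :
    ContDiff ℝ ∞ (fun x => (f x).ν) :=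
  (contDiff_fiber hf).snd.snd.snd

/-- The base component of a curve in the Pontryagin bundle. -/
def baseCurve (γ : PontryaginCurve E G) : SmoothCurve 𝓘(ℝ, E) G :=
  ⟨fun t => (γ t).g, contMDiff_base γ.contMDiff⟩

end Components

variable [LieGroup 𝓘(ℝ, E) ∞ G]

theorem leftVelocity_congr {g h : SmoothCurve 𝓘(ℝ, E) G} {a : ℝ}
    (H : ∀ t ∈ Icc 0 a, g t = h t) {t : ℝ} (ht : t ∈ Ioo 0 a) :
    leftVelocity (E := E) g t = leftVelocity h t := by
  rw [leftVelocity_eq_maurerCartan g.contMDiff, leftVelocity_eq_maurerCartan h.contMDiff,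
    maurerCartan, maurerCartan]
  refine congrArg (fun A : ℝ →L[ℝ] E => A 1) (EventuallyEq.fderiv_eq ?_)
  filter_upwards [Ioo_mem_nhds ht.1 ht.2] with s hs
  rw [H t (Ioo_subset_Icc_self ht), H s (Ioo_subset_Icc_self hs)]

theorem contDiff_ad [CompleteSpace E] {X : Type*} [NormedAddCommGroup X] [NormedSpace ℝ X]
    {v η : X → E} (hv : ContDiff ℝ ∞ v) (hη : ContDiff ℝ ∞ η) :
    ContDiff ℝ ∞ (fun t => ad G (v t) (η t)) := by
  simp only [← adL_apply]
  exact ((adL E G).contDiff.comp hv).clm_apply hη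

theorem reducedHamiltonPrinciple_iff [CompleteSpace E] {a : ℝ} (ha : 0 < a) {ℓ : E × E → ℝ}
    (hℓ : ContDiff ℝ ∞ ℓ) {v : ℝ → E} (hv : ContDiff ℝ ∞ v) :
    ReducedHamiltonPrinciple G a ℓ v ↔ IsReducedCritical G a ℓ v := by
  refine forall_congr' fun η => forall_congr' fun hη => ?_
  refine forall_congr' fun _ => forall_congr' fun _ => forall_congr' fun _ => forall_congr' fun _ => ?_
  have hw : ContDiff ℝ ∞ fun t => deriv η t + ad G (v t) (η t) :=
    (contDiff_deriv hη).add (contDiff_ad hv hη)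
  have hd := hasDerivAt_reducedAction ha hℓ
    (W := fun p => v p.2 + p.1 • (deriv η p.2 + ad G (v p.2) (η p.2)))
    ((hv.comp contDiff_snd).add (contDiff_fst.smul (hw.comp contDiff_snd))) (v := v)
    (w := fun t => deriv η t + ad G (v t) (η t)) (fun t _ => by simp) (fun t _ => by
      simpa using ((hasDerivAt_id (0 : ℝ)).smul_const (deriv η t + ad G (v t) (η t))).const_add (v t))
  exact ⟨fun h => hd.unique h, fun h => by rwa [h] at hd⟩

theorem hasDerivAt_action [CompleteSpace E] {a : ℝ} (ha : 0 < a)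
    {L : HigherTangentBundle E G 2 → ℝ} {ℓ : E × E → ℝ}
    (hℓ : ContDiff ℝ ∞ ℓ) (hL : IsReducedLagrangian L ℓ) {g : SmoothCurve 𝓘(ℝ, E) G}
    {Γ : ℝ → SmoothCurve 𝓘(ℝ, E) G} (hΓ : IsDeformation a g Γ) {η : ℝ → E}
    (hη : ∀ t, leftVelocity (fun ε => Γ ε t) 0 = η t) :
    HasDerivAt (fun ε => action a L (Γ ε))
      (∫ t in (0 : ℝ)..a, fderiv ℝ ℓ (leftVelocity g t, deriv (leftVelocity g) t)
        (deriv η t + ad G (leftVelocity g t) (η t),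
          deriv (fun s => deriv η s + ad G (leftVelocity g s) (η s)) t)) 0 := by
  simp only [action_eq_reducedAction hL]
  have h0 : ∀ t ∈ Ioo 0 a, leftVelocity (E := E) (Γ 0) t = leftVelocity g t := fun t ht =>
    leftVelocity_congr hΓ.start ht
  refine hasDerivAt_reducedAction ha hℓ
    (W := fun p => leftVelocity (Γ p.1) p.2) (contDiff_leftVelocity_snd hΓ.smooth)
    (v := leftVelocity g) (w := fun t => deriv η t + ad G (leftVelocity g t) (η t)) h0 ?_
  intro t ht
  have h := hasDerivAt_leftVelocity_variation hΓ.smooth 0 t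
  simp only [hη] at h
  rw [← h0 t ht]
  exact h

theorem hamiltonPrinciple_iff [FiniteDimensional ℝ E] {a : ℝ} (ha : 0 < a)
    {L : HigherTangentBundle E G 2 → ℝ} {ℓ : E × E → ℝ}
    (hℓ : ContDiff ℝ ∞ ℓ) (hL : IsReducedLagrangian L ℓ) (g : SmoothCurve 𝓘(ℝ, E) G) :
    HamiltonPrinciple a L g ↔ IsReducedCritical G a ℓ (leftVelocity g) := by
  constructor
  · intro H η hη h0 ha0 h0' ha0'
    obtain ⟨Γ, hs, hst, hv, -, hlift⟩ := exists_deformation g hη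
    have hΓ : IsDeformation a g Γ := ⟨hs, fun t _ => hst t⟩
    exact (hasDerivAt_action ha hℓ hL hΓ hv).unique
      (H Γ hΓ (hlift 0 h0 h0') (hlift a ha0 ha0'))
  · intro H Γ hΓ hl0 hla
    set η : ℝ → E := fun t => leftVelocity (fun ε => Γ ε t) 0 with hη
    have hend : ∀ t, (∀ ε, tangentLift E (Γ ε) t = tangentLift E g t) →
        η t = 0 ∧ deriv η t = 0 := by
      intro t ht
      have h1 : η t = 0 := by
        have : (fun ε => Γ ε t) = fun _ => g t :=
          funext fun ε => congrArg Bundle.TotalSpace.proj (ht ε)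
        rw [hη]
        simp only [this]
        exact leftVelocity_eq_zero_of_velocity (velocity_const E (g t) 0)
      refine ⟨h1, ?_⟩
      -- With the lift at `t` fixed, the left velocity is constant in `ε`, so `η̇ + ad_v η = 0`
      -- there; since `η = 0`, also `η̇ = 0`.
      have h2 := hasDerivAt_leftVelocity_variation hΓ.smooth 0 t
      have h3 : (fun ε => leftVelocity (E := E) (fun s => Γ ε s) t) = fun _ => leftVelocity g t :=
        funext fun ε => leftVelocity_eq_of_tangentLift_eq E (ht ε)
      simp only [h3] at h2
      have h4 := h2.unique (hasDerivAt_const 0 _)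
      change deriv η t + ad G _ (η t) = 0 at h4
      rwa [h1, ← adL_apply, map_zero, add_zero] at h4
    have := hasDerivAt_action ha hℓ hL hΓ (η := η) fun t => rfl
    rwa [H η (contDiff_leftVelocity_fst hΓ.smooth 0) (hend 0 hl0).1 (hend a hla).1
      (hend 0 hl0).2 (hend a hla).2] at this

variable [FiniteDimensional ℝ E]

/-- Integration by parts with the momenta. -/
theorem integral_reduced_variation {a : ℝ} (ha : 0 < a) {ℓ : E × E → ℝ}
    {v η : ℝ → E} (hv : ContDiff ℝ ∞ v) (hη : ContDiff ℝ ∞ η) {μ ν : ℝ → StrongDual ℝ E}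
    (hμ : ContDiff ℝ ∞ μ) (hν : ContDiff ℝ ∞ ν)
    (hμeq : ∀ t ∈ Ioo 0 a, ∀ x, μ t x = fderiv ℝ ℓ (v t, deriv v t) (x, 0) - deriv ν t x)
    (hνeq : ∀ t ∈ Ioo 0 a, ∀ x, ν t x = fderiv ℝ ℓ (v t, deriv v t) (0, x))
    (h0 : η 0 = 0) (ha0 : η a = 0) (h0' : deriv η 0 = 0) (ha0' : deriv η a = 0) :
    ∫ t in (0 : ℝ)..a, fderiv ℝ ℓ (v t, deriv v t)
      (deriv η t + ad G (v t) (η t), deriv (fun s => deriv η s + ad G (v s) (η s)) t) =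
    ∫ t in (0 : ℝ)..a, (μ t (ad G (v t) (η t)) - deriv μ t (η t)) := by
  have hη' := contDiff_deriv hη
  set w : ℝ → E := fun t => deriv η t + ad G (v t) (η t) with hwdef
  have hw : ContDiff ℝ ∞ w := hη'.add (contDiff_ad hv hη)
  -- This is the boundary term of the integration by parts. It vanishes at both ends because `η` and
  -- `η̇`, hence `w = δv`, vanish there.
  have hh : ContDiff ℝ ∞ fun t => μ t (η t) + ν t (w t) :=
    (hμ.clm_apply hη).add (hν.clm_apply hw)
  have hw0 : ∀ t, η t = 0 → deriv η t = 0 → w t = 0 := fun t h h' => by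
    rw [hwdef]
    simp only [h, h', ← adL_apply, map_zero, add_zero]
  rw [← integral_add_deriv_eq (a := a)
    (f := fun t => μ t (ad G (v t) (η t)) - deriv μ t (η t)) ?_ hh (by simp [h0, hw0 0 h0 h0'])
    (by simp [ha0, hw0 a ha0 ha0'])]
  · refine integral_congr_Ioo ha fun t ht => ?_
    have hd := ((hasDerivAt_deriv hμ t).clm_apply (hasDerivAt_deriv hη t)).add
      ((hasDerivAt_deriv hν t).clm_apply (hasDerivAt_deriv hw t))
    have hd' : deriv (fun t => μ t (η t) + ν t (w t)) t = _ := hd.deriv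
    have hsplit : (w t, deriv w t) = (w t, 0) + (0, deriv w t) := by simp
    have e1 := hμeq t ht (w t)
    have e2 := hνeq t ht (deriv w t)
    have e3 : μ t (w t) = μ t (deriv η t) + μ t (ad G (v t) (η t)) := map_add _ _ _
    rw [hd', hsplit, map_add, ← e2]
    linarith
  · exact ((hμ.clm_apply (contDiff_ad hv hη)).sub ((contDiff_deriv hμ).clm_apply hη)).continuous

theorem isReducedCritical_iff {a : ℝ} (ha : 0 < a) {ℓ : E × E → ℝ} (hℓ : ContDiff ℝ ∞ ℓ)
    (g : SmoothCurve 𝓘(ℝ, E) G) :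
    IsReducedCritical G a ℓ (leftVelocity g) ↔
      ∃ γ : PontryaginCurve E G, ProjectsTo a γ g ∧ HPEquations a ℓ γ := by
  set v : ℝ → E := leftVelocity g with hvdef
  have hv : ContDiff ℝ ∞ v := contDiff_leftVelocity g.contMDiff
  have hv' := contDiff_deriv hv
  constructor
  · intro H
    have hDℓ : ContDiff ℝ ∞ fun t => fderiv ℝ ℓ (v t, deriv v t) :=
      (hℓ.fderiv_right (m := ∞) (by simp)).comp (hv.prodMk hv')
    -- The Ostrogradsky formulas define the momenta from `v`, so only the Euler–Poincaré equation is
    -- left to prove. It is tested with `η = φ • e`.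
    set ν : ℝ → StrongDual ℝ E := fun t =>
      (fderiv ℝ ℓ (v t, deriv v t)).comp (.inr ℝ E E) with hνdef
    have hν : ContDiff ℝ ∞ ν := hDℓ.clm_comp contDiff_const
    set μ : ℝ → StrongDual ℝ E := fun t =>
      (fderiv ℝ ℓ (v t, deriv v t)).comp (.inl ℝ E E) - deriv ν t with hμdef
    have hμ : ContDiff ℝ ∞ μ := (hDℓ.clm_comp contDiff_const).sub (contDiff_deriv hν)
    refine ⟨mkPontryaginCurve g (fun t => (v t, deriv v t, μ t, ν t))
      (hv.prodMk (hv'.prodMk (hμ.prodMk hν))), fun t _ => rfl, ?_⟩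
    refine ⟨fun t ht e => ?_, fun t _ => ?_, fun t _ => ?_, fun t _ => ?_, fun t _ => rfl⟩
    · have hf : Continuous fun t => μ t (ad G (v t) e) - deriv μ t e :=
        ((hμ.clm_apply (contDiff_ad hv contDiff_const)).sub
          ((contDiff_deriv hμ).clm_apply contDiff_const)).continuous
      have key := eq_zero_of_integral_mul_eq_zero ha hf (fun φ hφ h0 h1 h0' h1' => ?_) t ht
      · exact (sub_eq_zero.1 key).symm
      · have hη : ContDiff ℝ ∞ fun t => φ t • e := hφ.smul contDiff_const
        have hηd : ∀ t, deriv (fun t => φ t • e) t = deriv φ t • e := fun t =>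
          ((hasDerivAt_deriv hφ t).smul_const e).deriv
        have hint := integral_reduced_variation (G := G) ha (ℓ := ℓ) hv hη hμ hν
          (fun t _ x => rfl) (fun t _ x => rfl) (by simp [h0]) (by simp [h1])
          (by simp [hηd, h0']) (by simp [hηd, h1'])
        rw [H _ hη (by simp [h0]) (by simp [h1]) (by simp [hηd, h0']) (by simp [hηd, h1'])] at hint
        refine Eq.trans ?_ hint.symm
        refine intervalIntegral.integral_congr fun t _ => ?_
        simp [← adL_apply, mul_sub]
    · rw [fderiv_partial_fst hℓ]
      rfl
    · rw [fderiv_partial_snd hℓ]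
      rfl
    · exact velocity_eq_mulInvariantVectorField_iff.2 rfl
  · rintro ⟨γ, hγ, hEq⟩ η hη h0 h1 h0' h1'
    -- Reconstruction identifies `ξ` and `u` with `v` and `v̇`, so the given momenta satisfy the
    -- hypotheses of the integration by parts.
    have hξ : ∀ t ∈ Ioo 0 a, (γ t).ξ = v t := fun t ht => by
      rw [← velocity_eq_mulInvariantVectorField_iff.1
        (hEq.reconstruction_g t (Ioo_subset_Icc_self ht))]
      exact leftVelocity_congr (g := baseCurve γ) hγ ht
    have hu : ∀ t ∈ Ioo 0 a, (γ t).u = deriv v t := fun t ht => by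
      rw [← hEq.reconstruction_xi t (Ioo_subset_Icc_self ht)]
      exact EventuallyEq.deriv_eq
        (by filter_upwards [Ioo_mem_nhds ht.1 ht.2] with s hs using hξ s hs)
    rw [integral_reduced_variation ha hv hη (contDiff_mu γ.contMDiff) (contDiff_nu γ.contMDiff)
      ?_ ?_ h0 h1 h0' h1']
    · rw [integral_congr_Ioo ha (g := fun _ => 0), intervalIntegral.integral_zero]
      intro t ht
      rw [hEq.euler_poincare t (Ioo_subset_Icc_self ht), hξ t ht, sub_self]
    · intro t ht x
      rw [hEq.momentum_mu t (Ioo_subset_Icc_self ht), fderiv_partial_fst hℓ, hξ t ht, hu t ht]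
      rfl
    · intro t ht x
      rw [hEq.momentum_nu t (Ioo_subset_Icc_self ht), fderiv_partial_snd hℓ, hξ t ht, hu t ht]
      rfl

end Stationarity

/-! ### The Hamilton–Pontryagin principle. -/

section HamiltonPontryagin

variable {E : Type*} [NormedAddCommGroup E] [NormedSpace ℝ E]
  {G : Type*} [TopologicalSpace G] [ChartedSpace E G] [Group G]

theorem contDiff_variation {F : Type*} [NormedAddCommGroup F] [NormedSpace ℝ F]
    {W : ℝ × ℝ → F} (hW : ContDiff ℝ ∞ W) {w : ℝ → F}
    (hw : ∀ t, HasDerivAt (fun ε => W (ε, t)) (w t) 0) : ContDiff ℝ ∞ w := by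
  have : w = fun t => fderiv ℝ W (0, t) (1, 0) :=
    funext fun t => (hw t).unique (hasDerivAt_fst hW 0 t)
  rw [this]
  exact (contDiff_fderiv_apply hW (1, 0)).comp (contDiff_const.prodMk contDiff_id)

theorem contDiff_smul_vec {F : Type*} [NormedAddCommGroup F] [NormedSpace ℝ F] {φ : ℝ → ℝ}
    (hφ : ContDiff ℝ ∞ φ) (x : F) : ContDiff ℝ ∞ fun t => φ t • x :=
  hφ.smul contDiff_const

/-- The integrand of the first variation of the Hamilton–Pontryagin action, after integration by
parts. -/
def hpVariation (ℓ : E × E → ℝ) (γ : PontryaginCurve E G) (η δξ δu : ℝ → E)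
    (δμ δν : ℝ → StrongDual ℝ E) (t : ℝ) : ℝ :=
  fderiv ℝ ℓ ((γ t).ξ, (γ t).u) (δξ t, δu t)
    - ((γ t).μ (δξ t) + deriv (fun s => (γ s).ν) t (δξ t)) - (γ t).ν (δu t)
    + δμ t (leftVelocity (fun s => (γ s).g) t - (γ t).ξ)
    + δν t (deriv (fun s => (γ s).ξ) t - (γ t).u)
    + ((γ t).μ (ad G (leftVelocity (fun s => (γ s).g) t) (η t))
      - deriv (fun s => (γ s).μ) t (η t))

variable [LieGroup 𝓘(ℝ, E) ∞ G]

theorem hasDerivAt_hpAction [CompleteSpace E] {a : ℝ} (ha : 0 < a) {ℓ : E × E → ℝ}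
    (hℓ : ContDiff ℝ ∞ ℓ) {γ : PontryaginCurve E G} {Γ : ℝ → PontryaginCurve E G}
    (hΓ : IsDeformation a γ Γ) {η δξ δu : ℝ → E} {δμ δν : ℝ → StrongDual ℝ E}
    (hη : ∀ t, leftVelocity (fun ε => (Γ ε t).g) 0 = η t)
    (hξ : ∀ t, HasDerivAt (fun ε => (Γ ε t).ξ) (δξ t) 0)
    (hu : ∀ t, HasDerivAt (fun ε => (Γ ε t).u) (δu t) 0)
    (hμ : ∀ t, HasDerivAt (fun ε => (Γ ε t).μ) (δμ t) 0)
    (hν : ∀ t, HasDerivAt (fun ε => (Γ ε t).ν) (δν t) 0)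
    (hη0 : η 0 = 0) (hηa : η a = 0) (hξ0 : δξ 0 = 0) (hξa : δξ a = 0) :
    HasDerivAt (fun ε => hpAction a ℓ (Γ ε))
      (∫ t in (0 : ℝ)..a, hpVariation ℓ γ η δξ δu δμ δν t) 0 := by
  have sg := contMDiff_base hΓ.smooth
  have sξ := contDiff_xi hΓ.smooth
  have su := contDiff_u hΓ.smooth
  have sμ := contDiff_mu hΓ.smooth
  have sν := contDiff_nu hΓ.smooth
  have sv := contDiff_leftVelocity_snd sg
  have cξ := contDiff_xi γ.contMDiff
  have cu := contDiff_u γ.contMDiff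
  have cμ := contDiff_mu γ.contMDiff
  have cν := contDiff_nu γ.contMDiff
  have cv := contDiff_leftVelocity (baseCurve γ).contMDiff
  have dη : ContDiff ℝ ∞ η := funext hη ▸ contDiff_leftVelocity_fst sg 0
  have dξ := contDiff_variation sξ hξ
  have du := contDiff_variation su hu
  have dμ := contDiff_variation sμ hμ
  have dν := contDiff_variation sν hν
  -- Only `g` and `ξ` are differentiated in the action, so the boundary term involves `η` and `δξ`
  -- alone; `δu`, `δμ`, `δν` need no endpoint conditions.
  have hpar : ContDiff ℝ ∞ fun t => (γ t).μ (η t) + (γ t).ν (δξ t) :=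
    (cμ.clm_apply dη).add (cν.clm_apply dξ)
  have hcont : Continuous (hpVariation ℓ γ η δξ δu δμ δν) := by
    have hDℓ : ContDiff ℝ ∞ fun t => fderiv ℝ ℓ ((γ t).ξ, (γ t).u) :=
      (hℓ.fderiv_right (m := ∞) (by simp)).comp (cξ.prodMk cu)
    exact ((((((hDℓ.clm_apply (dξ.prodMk du)).sub
      ((cμ.clm_apply dξ).add ((contDiff_deriv cν).clm_apply dξ))).sub (cν.clm_apply du)).add
      (dμ.clm_apply (cv.sub cξ))).add (dν.clm_apply ((contDiff_deriv cξ).sub cu))).add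
      ((cμ.clm_apply (contDiff_ad cv dη)).sub ((contDiff_deriv cμ).clm_apply dη))).continuous
  rw [← integral_add_deriv_eq hcont hpar (by simp [hη0, hξ0]) (by simp [hηa, hξa])]
  refine hasDerivAt_integral_of_contDiff ha
    (W := fun p => ℓ ((Γ p.1 p.2).ξ, (Γ p.1 p.2).u)
      + (Γ p.1 p.2).μ (leftVelocity (fun s => (Γ p.1 s).g) p.2 - (Γ p.1 p.2).ξ)
      + (Γ p.1 p.2).ν (deriv (fun s => (Γ p.1 s).ξ) p.2 - (Γ p.1 p.2).u))
    (((hℓ.comp (sξ.prodMk su)).add (sμ.clm_apply (sv.sub sξ))).add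
      (sν.clm_apply ((contDiff_deriv_snd sξ).sub su))) fun t ht => ?_
  have e0 : Γ 0 t = γ t := hΓ.start t (Ioo_subset_Icc_self ht)
  have ev : leftVelocity (E := E) (fun s => (Γ 0 s).g) t = leftVelocity (fun s => (γ s).g) t :=
    leftVelocity_congr (g := baseCurve (Γ 0)) (h := baseCurve γ)
      (fun s hs => congrArg (fun q : PontryaginBundle E G => q.g) (hΓ.start s hs)) ht
  have eξ : deriv (fun s => (Γ 0 s).ξ) t = deriv (fun s => (γ s).ξ) t :=
    EventuallyEq.deriv_eq (by
      filter_upwards [Ioo_mem_nhds ht.1 ht.2] with s hs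
      rw [hΓ.start s (Ioo_subset_Icc_self hs)])
  have hv := hasDerivAt_leftVelocity_variation sg 0 t
  simp only [hη] at hv
  have hξ' := hasDerivAt_deriv_snd sξ 0 t
  simp only [(hξ _).deriv] at hξ'
  have hℓd := ((hℓ.differentiable (by simp) ((Γ 0 t).ξ, (Γ 0 t).u)).hasFDerivAt).comp_hasDerivAt
    (0 : ℝ) ((hξ t).prodMk (hu t))
  have key := (hℓd.add ((hμ t).clm_apply (hv.sub (hξ t)))).add
    ((hν t).clm_apply (hξ'.sub (hu t)))
  refine key.congr_deriv ?_
  have hd : deriv (fun t => (γ t).μ (η t) + (γ t).ν (δξ t)) t = _ :=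
    (((hasDerivAt_deriv cμ t).clm_apply (hasDerivAt_deriv dη t)).add
      ((hasDerivAt_deriv cν t).clm_apply (hasDerivAt_deriv dξ t))).deriv
  rw [hd, hpVariation]
  simp only [ev, eξ, e0, map_add, map_sub, Pi.sub_apply]
  ring

theorem HPEquations.isHPStationary [FiniteDimensional ℝ E] {a : ℝ} (ha : 0 < a) {ℓ : E × E → ℝ}
    (hℓ : ContDiff ℝ ∞ ℓ) {γ : PontryaginCurve E G} (h : HPEquations a ℓ γ) :
    IsHPStationary a ℓ γ := by
  intro Γ hΓ hg0 hga hξ0 hξa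
  have hvar : ∀ {F : Type _} [NormedAddCommGroup F] [NormedSpace ℝ F] {W : ℝ × ℝ → F},
      ContDiff ℝ ∞ W → ∀ t, HasDerivAt (fun ε => W (ε, t)) (deriv (fun ε => W (ε, t)) 0) 0 :=
    fun hW t => (hasDerivAt_fst hW 0 t).differentiableAt.hasDerivAt
  have key := hasDerivAt_hpAction ha hℓ hΓ (fun t => rfl) (hvar (contDiff_xi hΓ.smooth))
    (hvar (contDiff_u hΓ.smooth)) (hvar (contDiff_mu hΓ.smooth)) (hvar (contDiff_nu hΓ.smooth))
    (leftVelocity_eq_zero_of_velocity hg0) (leftVelocity_eq_zero_of_velocity hga) hξ0 hξa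
  rwa [integral_congr_Ioo ha (g := fun _ => 0), intervalIntegral.integral_zero] at key
  intro t ht
  have ht' := Ioo_subset_Icc_self ht
  have hv := velocity_eq_mulInvariantVectorField_iff.1 (h.reconstruction_g t ht')
  rw [hpVariation, hv, h.reconstruction_xi t ht', h.euler_poincare t ht', h.momentum_mu t ht',
    h.momentum_nu t ht', fderiv_partial_fst hℓ, fderiv_partial_snd hℓ]
  generalize deriv (fun ε => (Γ ε t).ξ) 0 = x
  generalize deriv (fun ε => (Γ ε t).u) 0 = y
  have hsplit : (x, y) = (x, 0) + (0, y) := by simp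
  rw [hsplit, map_add]
  simp

/-- All five variations can be prescribed at once: the base is deformed by `exists_deformation`, and
the vector-space components are moved along straight lines. -/
theorem IsHPStationary.integral_eq_zero [FiniteDimensional ℝ E] {a : ℝ} (ha : 0 < a)
    {ℓ : E × E → ℝ} (hℓ : ContDiff ℝ ∞ ℓ) {γ : PontryaginCurve E G} (h : IsHPStationary a ℓ γ)
    {η δξ δu : ℝ → E} {δμ δν : ℝ → StrongDual ℝ E} (dη : ContDiff ℝ ∞ η) (dξ : ContDiff ℝ ∞ δξ)
    (du : ContDiff ℝ ∞ δu) (dμ : ContDiff ℝ ∞ δμ) (dν : ContDiff ℝ ∞ δν)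
    (hη0 : η 0 = 0) (hηa : η a = 0) (hξ0 : δξ 0 = 0) (hξa : δξ a = 0) :
    ∫ t in (0 : ℝ)..a, hpVariation ℓ γ η δξ δu δμ δν t = 0 := by
  obtain ⟨Γ, hs, hst, hv, hfix, -⟩ := exists_deformation (baseCurve γ) dη
  have cγ := contDiff_fiber γ.contMDiff
  have hc : ContDiff ℝ ∞ fun p : ℝ × ℝ =>
      (γ p.2).2 + p.1 • (δξ p.2, δu p.2, δμ p.2, δν p.2) :=
    (cγ.comp contDiff_snd).add (contDiff_fst.smul
      ((dξ.prodMk (du.prodMk (dμ.prodMk dν))).comp contDiff_snd))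
  set Δ : ℝ → PontryaginCurve E G := fun ε => mkPontryaginCurve (Γ ε)
    (fun t => (γ t).2 + ε • (δξ t, δu t, δμ t, δν t))
    (hc.comp (contDiff_const.prodMk contDiff_id)) with hΔdef
  have hΔ : IsDeformation a γ Δ := by
    refine ⟨hs.prodMk hc.contMDiff, fun t _ => ?_⟩
    refine Prod.ext (hst t) ?_
    change (γ t).2 + (0 : ℝ) • _ = _
    rw [zero_smul, add_zero]
  have hlin : ∀ {F : Type _} [NormedAddCommGroup F] [NormedSpace ℝ F] (x y : F),
      HasDerivAt (fun ε : ℝ => x + ε • y) y 0 := fun x y => by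
    simpa using ((hasDerivAt_id (0 : ℝ)).smul_const y).const_add x
  have hend : ∀ t, η t = 0 → velocity E (fun ε => (Δ ε t).g) 0 = 0 := fun t ht => by
    have : (fun ε => (Δ ε t).g) = fun _ => (γ t).g := funext fun ε => hfix t ht ε
    rw [this]
    exact velocity_const E _ _
  have key := hasDerivAt_hpAction ha hℓ hΔ hv (fun t => hlin (γ t).ξ (δξ t))
    (fun t => hlin (γ t).u (δu t)) (fun t => hlin (γ t).μ (δμ t))
    (fun t => hlin (γ t).ν (δν t)) hη0 hηa hξ0 hξa
  exact key.unique (h Δ hΔ (hend 0 hη0) (hend a hηa) ((hlin _ _).deriv.trans hξ0)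
    ((hlin _ _).deriv.trans hξa))

theorem IsHPStationary.hpEquations [FiniteDimensional ℝ E] {a : ℝ} (ha : 0 < a)
    {ℓ : E × E → ℝ} (hℓ : ContDiff ℝ ∞ ℓ) {γ : PontryaginCurve E G} (h : IsHPStationary a ℓ γ) :
    HPEquations a ℓ γ := by
  have cξ := contDiff_xi γ.contMDiff
  have cu := contDiff_u γ.contMDiff
  have cμ := contDiff_mu γ.contMDiff
  have cν := contDiff_nu γ.contMDiff
  have cv : ContDiff ℝ ∞ (leftVelocity (E := E) fun s => (γ s).g) :=
    contDiff_leftVelocity (baseCurve γ).contMDiff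
  have hDℓ : ContDiff ℝ ∞ fun t => fderiv ℝ ℓ ((γ t).ξ, (γ t).u) :=
    (hℓ.fderiv_right (m := ∞) (by simp)).comp (cξ.prodMk cu)
  have zE : ContDiff ℝ ∞ fun _ : ℝ => (0 : E) := contDiff_const
  have zD : ContDiff ℝ ∞ fun _ : ℝ => (0 : StrongDual ℝ E) := contDiff_const
  have had0 : ∀ v : E, ad G v 0 = 0 := fun v => by rw [← adL_apply, map_zero]
  -- Each equation comes from varying one component, as a scalar test function times a fixed vector
  -- or covector, with the others zero. Here `δμ = φ • l`, and the functionals `l` separate points.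
  have heq_v : ∀ t ∈ Icc 0 a, leftVelocity (fun s => (γ s).g) t = (γ t).ξ := fun t ht => by
    refine sub_eq_zero.1 (SeparatingDual.eq_zero_of_forall_dual_eq_zero (R := ℝ) fun l => ?_)
    refine eq_zero_of_integral_mul_eq_zero ha
      (f := fun t => l (leftVelocity (fun s => (γ s).g) t - (γ t).ξ))
      (l.contDiff.comp (cv.sub cξ)).continuous (fun φ hφ _ _ _ _ => ?_) t ht
    refine Eq.trans ?_ (h.integral_eq_zero ha hℓ zE zE zE (contDiff_smul_vec hφ l) zD rfl rfl rfl rfl)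
    refine intervalIntegral.integral_congr fun t _ => ?_
    simp [hpVariation, had0, ← Prod.zero_eq_mk]
  have heq_u : ∀ t ∈ Icc 0 a, deriv (fun s => (γ s).ξ) t = (γ t).u := fun t ht => by
    refine sub_eq_zero.1 (SeparatingDual.eq_zero_of_forall_dual_eq_zero (R := ℝ) fun l => ?_)
    refine eq_zero_of_integral_mul_eq_zero ha
      (f := fun t => l (deriv (fun s => (γ s).ξ) t - (γ t).u))
      (l.contDiff.comp ((contDiff_deriv cξ).sub cu)).continuous (fun φ hφ _ _ _ _ => ?_) t ht
    refine Eq.trans ?_ (h.integral_eq_zero ha hℓ zE zE zE zD (contDiff_smul_vec hφ l) rfl rfl rfl rfl)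
    refine intervalIntegral.integral_congr fun t _ => ?_
    simp [hpVariation, had0, ← Prod.zero_eq_mk]
  have heq_ep : ∀ t ∈ Icc 0 a, ∀ e : E, (γ t).μ (ad G (leftVelocity (fun s => (γ s).g) t) e) -
      deriv (fun s => (γ s).μ) t e = 0 := fun t ht e => by
    refine eq_zero_of_integral_mul_eq_zero ha
      (f := fun t => (γ t).μ (ad G (leftVelocity (fun s => (γ s).g) t) e) -
        deriv (fun s => (γ s).μ) t e)
      ((cμ.clm_apply (contDiff_ad cv contDiff_const)).sub
        ((contDiff_deriv cμ).clm_apply contDiff_const)).continuous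
      (fun φ hφ h0 h1 _ _ => ?_) t ht
    refine Eq.trans ?_ (h.integral_eq_zero ha hℓ (contDiff_smul_vec hφ e) zE zE zD zD
      (by simp [h0]) (by simp [h1]) rfl rfl)
    refine intervalIntegral.integral_congr fun t _ => ?_
    simp [hpVariation, ← adL_apply, ← Prod.zero_eq_mk, mul_sub]
  have heq_mu : ∀ t ∈ Icc 0 a, ∀ e : E, fderiv ℝ ℓ ((γ t).ξ, (γ t).u) (e, 0) -
      ((γ t).μ e + deriv (fun s => (γ s).ν) t e) = 0 := fun t ht e => by
    refine eq_zero_of_integral_mul_eq_zero ha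
      (f := fun t => fderiv ℝ ℓ ((γ t).ξ, (γ t).u) (e, 0) -
        ((γ t).μ e + deriv (fun s => (γ s).ν) t e))
      ((hDℓ.clm_apply contDiff_const).sub ((cμ.clm_apply contDiff_const).add
        ((contDiff_deriv cν).clm_apply contDiff_const))).continuous
      (fun φ hφ h0 h1 _ _ => ?_) t ht
    refine Eq.trans ?_ (h.integral_eq_zero ha hℓ zE (contDiff_smul_vec hφ e) zE zD zD
      rfl rfl (by simp [h0]) (by simp [h1]))
    refine intervalIntegral.integral_congr fun t _ => ?_
    have : (φ t • e, (0 : E)) = φ t • (e, (0 : E)) := by simp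
    simp [hpVariation, had0, this, mul_sub, mul_add, -Prod.smul_mk]
  have heq_nu : ∀ t ∈ Icc 0 a, ∀ e : E, fderiv ℝ ℓ ((γ t).ξ, (γ t).u) (0, e) -
      (γ t).ν e = 0 := fun t ht e => by
    refine eq_zero_of_integral_mul_eq_zero ha
      (f := fun t => fderiv ℝ ℓ ((γ t).ξ, (γ t).u) (0, e) - (γ t).ν e)
      ((hDℓ.clm_apply contDiff_const).sub (cν.clm_apply contDiff_const)).continuous
      (fun φ hφ _ _ _ _ => ?_) t ht
    refine Eq.trans ?_ (h.integral_eq_zero ha hℓ zE zE (contDiff_smul_vec hφ e) zD zD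
      rfl rfl rfl rfl)
    refine intervalIntegral.integral_congr fun t _ => ?_
    have : ((0 : E), φ t • e) = φ t • ((0 : E), e) := by simp
    simp [hpVariation, had0, this, mul_sub, -Prod.smul_mk]
  refine ⟨fun t ht e => ?_, fun t ht => ?_, fun t ht => ?_, fun t ht => ?_, heq_u⟩
  -- The `η`-variation gives the Euler–Poincaré equation with `g⁻¹ġ` in place of `ξ`; the
  -- `μ`-variation has shown that they agree.
  · rw [← heq_v t ht]
    exact (sub_eq_zero.1 (heq_ep t ht e)).symm
  · ext e
    rw [fderiv_partial_fst hℓ]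
    exact eq_sub_of_add_eq (sub_eq_zero.1 (heq_mu t ht e)).symm
  · ext e
    rw [fderiv_partial_snd hℓ]
    exact (sub_eq_zero.1 (heq_nu t ht e)).symm
  · exact velocity_eq_mulInvariantVectorField_iff.2 (heq_v t ht)

theorem isHPStationary_iff [FiniteDimensional ℝ E] {a : ℝ} (ha : 0 < a)
    {ℓ : E × E → ℝ} (hℓ : ContDiff ℝ ∞ ℓ) (γ : PontryaginCurve E G) :
    IsHPStationary a ℓ γ ↔ HPEquations a ℓ γ :=
  ⟨fun h => h.hpEquations ha hℓ, fun h => h.isHPStationary ha hℓ⟩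

end HamiltonPontryagin

end SecondOrderEP

end

/-- For a left-invariant second-order Lagrangian, Hamilton's principle, the reduced Hamilton's
principle and the reduced higher-order Hamilton–Pontryagin principle are equivalent, and each of
them is equivalent to the second-order Euler–Poincaré equations with the Ostrogradsky momenta and
the reconstruction equations. Moreover the stationary curves of the Hamilton–Pontryagin principle
are exactly the solutions of these equations. -/
theorem theorem2p1
    {E : Type*} [NormedAddCommGroup E] [NormedSpace ℝ E] [FiniteDimensional ℝ E]
    {G : Type*} [TopologicalSpace G] [ChartedSpace E G] [Group G] [LieGroup 𝓘(ℝ, E) ∞ G]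
    (a : ℝ) (ha : 0 < a)
    (L : SecondOrderEP.HigherTangentBundle E G 2 → ℝ)
    (ℓ : E × E → ℝ) (hℓ : ContDiff ℝ ∞ ℓ)
    (hL : SecondOrderEP.IsReducedLagrangian L ℓ)
    (g : SecondOrderEP.SmoothCurve 𝓘(ℝ, E) G) :
    List.TFAE [
      SecondOrderEP.HamiltonPrinciple a L g,
      SecondOrderEP.ReducedHamiltonPrinciple G a ℓ (SecondOrderEP.leftVelocity g),
      ∃ γ : SecondOrderEP.PontryaginCurve E G,
        SecondOrderEP.ProjectsTo a γ g ∧ SecondOrderEP.IsHPStationary a ℓ γ,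
      ∃ γ : SecondOrderEP.PontryaginCurve E G,
        SecondOrderEP.ProjectsTo a γ g ∧ SecondOrderEP.HPEquations a ℓ γ] ∧
    ∀ γ : SecondOrderEP.PontryaginCurve E G, SecondOrderEP.ProjectsTo a γ g →
      (SecondOrderEP.IsHPStationary a ℓ γ ↔ SecondOrderEP.HPEquations a ℓ γ) := by
  refine ⟨?_, fun γ _ => SecondOrderEP.isHPStationary_iff ha hℓ γ⟩
  have h1 := SecondOrderEP.hamiltonPrinciple_iff ha hℓ hL g
  have h2 := SecondOrderEP.reducedHamiltonPrinciple_iff (G := G) ha hℓ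
    (SecondOrderEP.contDiff_leftVelocity g.contMDiff)
  have h3 := SecondOrderEP.isReducedCritical_iff ha hℓ g
  tfae_have 1 ↔ 2 := h1.trans h2.symm
  tfae_have 2 ↔ 4 := h2.trans h3
  tfae_have 3 ↔ 4 := exists_congr fun γ =>
    and_congr_right fun _ => SecondOrderEP.isHPStationary_iff ha hℓ γ
  tfae_finish
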